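/- All theories are many-sorted and first-order; "definable" means definable without parameters, and elements of finite products of sorts count as elements of a model. For a set $A$ of elements of a structure $M$, $\mathrm{dcl}(A)$ is the set of all $b$ such that $\{b\}$ is defined by a formula with parameters from $A$; $A$ is definably closed if $\mathrm{dcl}(A)=A$. An interpretation $i$ of a theory $T_0$ in a theory $T$ assigns to the sorts, relations and functions of $T_0$ definable sets, relations and functions of $T$, so that every model $M$ of $T$ carries a model $M_0$ of $T_0$, viewed as a subset of $M$. It is stably embedded if for every definable family $Z\subseteq X\times i(Y_0)$ of $T$ there is a definable family $Z_0\subseteq W_0\times Y_0$ of $T_0$ such that, in every model of $T$, each fibre $Z_x$ equals $i(Z_0)_w$ for some $w\in i(W_0)$. A stably embedded interpretation $i$ makes $T$ an internal cover of $T_0$ if there is a stably embedded interpretation $\pi$ of $T$ in $T_0$ such that $\pi\circ i$ is the identity (up to isomorphism definable without parameters). **Proposition.** Let $T$ be an internal cover of $T_0$, where $T_0$ eliminates imaginaries. Let $G$ be the Galois pro-group of the cover, that is, a pro-group in $T$ (an inverse system of definable groups $G_k$ and definable homomorphisms over a directed set, $G(M)=\varprojlim_k G_k(M)$), with a definable action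 on every definable set of $T$, through which $G(M)$ is identified with $\mathrm{Aut}(M/M_0)$ for every model $M$ of $T$. Let $M$ be a model of $T$ and let $A\subseteq M$ be a set of internality parameters, that is, $A$ is definably closed and $\mathrm{dcl}(N_0\cup A)=N$ for every model $N$ of the theory of $M$ with constants for $A$. Let $A_0=A\cap M_0$. Let $B_0\subseteq M_0$ contain $A_0$ and be definably closed in the $T_0$-structure $M_0$, and let $B=\mathrm{dcl}(A\cup B_0)$, computed in $M$. Let $G(B)$ be the set of $g\in G(M)$ all of whose coordinates $g_k\in G_k(M)$ lie in $B$, and let $\mathrm{Aut}(B/B_0)$ be the group of (sort-preserving) permutations $\sigma$ of $B$ that fix $B_0$ pointwise and satisfy $x\in Q(M)\iff\sigma(x)\in Q(M)$ for every definable set $Q$ and every tuple $x$ from $B$. Then $G(B)$ is a subgroup of $G(M)$, and $G(B)=\mathrm{Aut}(B/B_0)$: the action of $G$ restricts to $B$ and gives an isomorphism of groups from $G(B)$ onto $\mathrm{Aut}(B/B_0)$. -/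

import Mathlib

universe u v w

namespace ManySorted

/-- A many-sorted first-order language. -/
structure Lang where
  Sorts : Type u
  Fun : List Sorts → Sorts → Type u
  Rel : List Sorts → Type u

/-- Elements of the product of the sorts `Γ i`. -/
abbrev Tuple {S : Type u} {ι : Type w} (M : S → Type v) (Γ : ι → S) : Type (max v w) :=
  ∀ i, M (Γ i)

/-- Concatenation of tuples. -/
def pair {S : Type u} {ι κ : Type*} {M : S → Type v} {Γ : ι → S} {Δ : κ → S}
    (x : Tuple M Γ) (y : Tuple M Δ) : Tuple M (Sum.elim Γ Δ)
  | Sum.inl i => x i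
  | Sum.inr j => y j

/-- Terms whose free variables are the `a : α` (of sort `Γ a`) and whose bound variables have
the sorts listed in `Δ`. -/
inductive Term (L : Lang.{u}) {α : Type w} (Γ : α → L.Sorts) (Δ : List L.Sorts) :
    L.Sorts → Type (max u w)
  | free (a : α) : Term L Γ Δ (Γ a)
  | bound (k : Fin Δ.length) : Term L Γ Δ (Δ.get k)
  | app {a : List L.Sorts} {s : L.Sorts} (f : L.Fun a s)
      (ts : ∀ k : Fin a.length, Term L Γ Δ (a.get k)) : Term L Γ Δ s

/-- First-order formulas; `all` binds a new variable, placed in front of the list `Δ`. -/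
inductive BForm (L : Lang.{u}) {α : Type w} (Γ : α → L.Sorts) : List L.Sorts → Type (max u w)
  | falsum {Δ : List L.Sorts} : BForm L Γ Δ
  | eq {Δ : List L.Sorts} {s : L.Sorts} (t₁ t₂ : Term L Γ Δ s) : BForm L Γ Δ
  | rel {Δ : List L.Sorts} {a : List L.Sorts} (R : L.Rel a)
      (ts : ∀ k : Fin a.length, Term L Γ Δ (a.get k)) : BForm L Γ Δ
  | imp {Δ : List L.Sorts} (φ ψ : BForm L Γ Δ) : BForm L Γ Δ
  | all {Δ : List L.Sorts} (s : L.Sorts) (φ : BForm L Γ (s :: Δ)) : BForm L Γ Δ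

/-- Formulas with free variables `a : α`, the variable `a` being of sort `Γ a`. -/
abbrev Formula (L : Lang.{u}) {α : Type w} (Γ : α → L.Sorts) : Type (max u w) := BForm L Γ []

/-- An `L`-structure (sorts may be empty). -/
structure Struc (L : Lang.{u}) where
  carrier : L.Sorts → Type u
  funMap : ∀ {a : List L.Sorts} {s : L.Sorts}, L.Fun a s → Tuple carrier a.get → carrier s
  relMap : ∀ {a : List L.Sorts}, L.Rel a → Tuple carrier a.get → Prop

instance (L : Lang.{u}) : CoeFun (Struc L) (fun _ => L.Sorts → Type u) := ⟨Struc.carrier⟩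

/-- The value of a term. -/
def Term.val {L : Lang.{u}} (M : Struc L) {α : Type w} {Γ : α → L.Sorts} {Δ : List L.Sorts}
    (x : Tuple M Γ) (e : Tuple M Δ.get) : ∀ {s : L.Sorts}, Term L Γ Δ s → M s
  | _, .free a => x a
  | _, .bound k => e k
  | _, .app f ts => M.funMap f (fun k => (ts k).val M x e)

/-- Extension of an assignment of the bound variables. -/
def consTuple {S : Type u} {M : S → Type v} {s : S} {Δ : List S} (b : M s)
    (e : Tuple M Δ.get) : Tuple M (s :: Δ).get
  | ⟨0, _⟩ => b
  | ⟨k + 1, h⟩ => e ⟨k, Nat.lt_of_succ_lt_succ h⟩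

/-- Truth of a formula under an assignment. -/
def BForm.Holds {L : Lang.{u}} (M : Struc L) {α : Type w} {Γ : α → L.Sorts} (x : Tuple M Γ) :
    ∀ {Δ : List L.Sorts}, BForm L Γ Δ → Tuple M Δ.get → Prop
  | _, .falsum, _ => False
  | _, .eq t₁ t₂, e => t₁.val M x e = t₂.val M x e
  | _, .rel R ts, e => M.relMap R (fun k => (ts k).val M x e)
  | _, .imp φ ψ, e => φ.Holds M x e → ψ.Holds M x e
  | _, .all s φ, e => ∀ b : M s, φ.Holds M x (consTuple b e)

/-- `φ(x)` is true in `M`. -/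
def Formula.Realize {L : Lang.{u}} {α : Type w} {Γ : α → L.Sorts} (φ : Formula L Γ)
    (M : Struc L) (x : Tuple M Γ) : Prop :=
  BForm.Holds M x φ (fun k => k.elim0)

/-- Sentences: formulas without free variables. -/
abbrev Sentence (L : Lang.{u}) : Type u := Formula L (fun a : Empty => (a.elim : L.Sorts))

/-- A theory is a set of sentences. -/
abbrev Theory (L : Lang.{u}) : Type u := Set (Sentence L)

/-- All sentences of `T` are true in `M`. -/
def Theory.IsModel {L : Lang.{u}} (T : Theory L) (M : Struc L) : Prop :=
  ∀ φ ∈ T, Formula.Realize φ M (fun a => a.elim)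

/-- Models of `T`. -/
structure Model {L : Lang.{u}} (T : Theory L) extends Struc L where
  isModel : T.IsModel toStruc

/-- A definable set (without parameters), inside a finite product of sorts. -/
structure DefSet (L : Lang.{u}) where
  ι : Type
  [fin : Finite ι]
  sort : ι → L.Sorts
  form : Formula L sort

/-- The set `X(M)`. -/
abbrev DefSet.pts {L : Lang.{u}} (X : DefSet L) (M : Struc L) : Type u :=
  {x : Tuple M X.sort // X.form.Realize M x}

/-- `T` eliminates imaginaries: every definable equivalence relation `E` on a definable set `X`
has the form `f x = f y` for a definable function `f` (with graph `F`) on `X`. -/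
def Theory.ElimImaginaries {L : Lang.{u}} (T : Theory L) : Prop :=
  ∀ (X : DefSet L) (E : Formula L (Sum.elim X.sort X.sort)),
    (∀ M : Model T, Equivalence
      (fun x y : X.pts M.toStruc => E.Realize M.toStruc (pair x.1 y.1))) →
    ∃ (κ : Type) (_ : Finite κ) (Γ : κ → L.Sorts) (F : Formula L (Sum.elim X.sort Γ)),
      ∀ M : Model T, ∃ f : X.pts M.toStruc → Tuple M.toStruc Γ,
        (∀ x y, f x = y ↔ F.Realize M.toStruc (pair x.1 y)) ∧
        ∀ x y, E.Realize M.toStruc (pair x.1 y.1) ↔ f x = f y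

/-! ### Definable closure and automorphisms -/

/-- A family of subsets of the sorts of a structure, that is, a set of its elements. -/
abbrev Subsets {L : Lang.{u}} (M : Struc L) : Type u := ∀ s, Set (M s)

/-- The definable closure: `b ∈ dcl M A` if `{b}` is defined by a formula with parameters
from `A`. -/
def dcl {L : Lang.{u}} (M : Struc L) (A : Subsets M) : Subsets M := fun s =>
  {b | ∃ φ : Formula L (Sum.elim (fun a : (Σ t, A t) => a.1) (fun _ : Unit => s)),
    ∀ y : M s, φ.Realize M (pair (fun a : (Σ t, A t) => a.2.1) (fun _ => y)) ↔ y = b}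

/-- `A` is definably closed. -/
def IsDefClosed {L : Lang.{u}} (M : Struc L) (A : Subsets M) : Prop := dcl M A ≤ A

/-- `Aut(B/F)`: the sortwise permutations of `B` that preserve all definable sets (as
computed in `M`) and fix the elements of `B` that lie in `F`. -/
def autGroup {L : Lang.{u}} (M : Struc L) (B F : Subsets M) :
    Subgroup (∀ s, Equiv.Perm (B s)) where
  carrier := {σ |
    (∀ (Q : DefSet L) (x : ∀ j, B (Q.sort j)),
      Q.form.Realize M (fun j => (x j).1) ↔ Q.form.Realize M (fun j => (σ _ (x j)).1)) ∧
    ∀ s (b : B s), b.1 ∈ F s → σ s b = b}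
  one_mem' := ⟨fun _ _ => Iff.rfl, fun _ _ _ => rfl⟩
  mul_mem' := by
    rintro σ τ ⟨h1, h2⟩ ⟨k1, k2⟩
    refine ⟨fun Q x => (k1 Q x).trans (h1 Q (fun j => τ _ (x j))), fun s b hb => ?_⟩
    change σ s (τ s b) = b
    rw [k2 s b hb, h2 s b hb]
  inv_mem' := by
    rintro σ ⟨h1, h2⟩
    refine ⟨fun Q x => ?_, fun s b hb => ?_⟩
    · have h := h1 Q (fun j => (σ _)⁻¹ (x j))
      have hx : (fun j => (σ (Q.sort j) ((σ _)⁻¹ (x j))).1) = fun j => (x j).1 :=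
        funext fun j => congrArg Subtype.val ((σ (Q.sort j)).apply_symm_apply (x j))
      rw [hx] at h
      exact h.symm
    · change (σ s)⁻¹ b = b
      rw [Equiv.Perm.inv_eq_iff_eq]
      exact (h2 s b hb).symm

/-- A map `j` from a set `A` of elements of `M` to `N` is elementary if it preserves the truth
of all formulas. This makes `N` a model of the theory of `M` with constants for `A`. -/
def IsElementary {L : Lang.{u}} (M N : Struc L) (A : Subsets M) (j : ∀ s, A s → N s) : Prop :=
  ∀ (Q : DefSet L) (x : ∀ k, A (Q.sort k)),
    Q.form.Realize M (fun k => (x k).1) ↔ Q.form.Realize N (fun k => j _ (x k))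

/-! ### Interpretations -/

/-- If each sort `s` of `L₀` is sent to the definable set `obj s`, these are the sorts of `L`
in which the product of the sets `obj (Γ k)` lies. -/
def flatSort {L₀ L : Lang.{u}} (obj : L₀.Sorts → DefSet L) {κ : Type w} (Γ : κ → L₀.Sorts) :
    (Σ k, (obj (Γ k)).ι) → L.Sorts :=
  fun p => (obj (Γ p.1)).sort p.2

/-- A tuple of elements of the sets `obj (Γ k)`, as a tuple of elements of sorts of `L`. -/
def flatten {L₀ L : Lang.{u}} {obj : L₀.Sorts → DefSet L} {M : Struc L} {κ : Type w}
    {Γ : κ → L₀.Sorts} (x : ∀ k, (obj (Γ k)).pts M) : Tuple M (flatSort obj Γ) :=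
  fun p => (x p.1).1 p.2

/-- The data of an interpretation of the language `L₀` in the theory `T`: a definable set for
each sort, a definable relation for each relation symbol, and a definable function for each
function symbol. -/
structure PreInterp (L₀ : Lang.{u}) {L : Lang.{u}} (T : Theory L) where
  obj : L₀.Sorts → DefSet L
  rel : ∀ {a : List L₀.Sorts}, L₀.Rel a → Formula L (flatSort obj a.get)
  graph : ∀ {a : List L₀.Sorts} {s : L₀.Sorts}, L₀.Fun a s →
    Formula L (Sum.elim (flatSort obj a.get) (obj s).sort)
  graph_total : ∀ (M : Model T) {a : List L₀.Sorts} {s : L₀.Sorts} (f : L₀.Fun a s)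
    (x : ∀ k, (obj (a.get k)).pts M.toStruc),
    ∃! y : (obj s).pts M.toStruc, (graph f).Realize M.toStruc (pair (flatten x) y.1)

/-- The `L₀`-structure `M₀` carried by a model `M` of `T`. -/
noncomputable def PreInterp.struc {L₀ L : Lang.{u}} {T : Theory L} (i : PreInterp L₀ T)
    (M : Model T) : Struc L₀ where
  carrier s := (i.obj s).pts M.toStruc
  funMap f x := (i.graph_total M f x).choose
  relMap R x := (i.rel R).Realize M.toStruc (flatten x)

/-- An interpretation of `T₀` in `T`. -/
structure Interp {L₀ L : Lang.{u}} (T₀ : Theory L₀) (T : Theory L) extends PreInterp L₀ T where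
  isModel : ∀ M : Model T, T₀.IsModel (toPreInterp.struc M)

/-- The model `M₀` of `T₀` carried by a model `M` of `T`. -/
noncomputable def Interp.res {L₀ L : Lang.{u}} {T₀ : Theory L₀} {T : Theory L}
    (i : Interp T₀ T) (M : Model T) : Model T₀ :=
  ⟨i.toPreInterp.struc M, i.isModel M⟩

/-- `i` is stably embedded: for every definable family `Z` (with parameters `x` in a product of
sorts of `T`) of subsets of a product of sorts of `T₀`, there is a definable family `Z₀` in `T₀`
such that in each model of `T` every `Z_x` is some `(Z₀)_w`. -/
def Interp.StablyEmbedded {L₀ L : Lang.{u}} {T₀ : Theory L₀} {T : Theory L}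
    (i : Interp T₀ T) : Prop :=
  ∀ (ι κ : Type) [Finite ι] [Finite κ] (Γ : ι → L.Sorts) (Γ₀ : κ → L₀.Sorts)
    (Z : Formula L (Sum.elim Γ (flatSort i.obj Γ₀))),
    ∃ (ν : Type) (_ : Finite ν) (Δ₀ : ν → L₀.Sorts) (Z₀ : Formula L₀ (Sum.elim Δ₀ Γ₀)),
      ∀ (M : Model T) (x : Tuple M.toStruc Γ), ∃ w : Tuple (i.res M).toStruc Δ₀,
        ∀ y : Tuple (i.res M).toStruc Γ₀,
          Z.Realize M.toStruc (pair x (flatten y)) ↔ Z₀.Realize (i.res M).toStruc (pair w y)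

/-- `π ∘ i` is the identity: there are bijections of `s` with `π (i s)`, for the sorts `s` of
`T₀`, definable in `T₀` without parameters (by the formulas `η s`), that form an isomorphism
from each model `N` of `T₀` to the model of `T₀` obtained from `N` through `π ∘ i`. -/
def Interp.CompIsId {L₀ L : Lang.{u}} {T₀ : Theory L₀} {T : Theory L}
    (π : Interp T T₀) (i : Interp T₀ T) : Prop :=
  ∃ η : ∀ s : L₀.Sorts,
      Formula L₀ (Sum.elim (fun _ : Unit => s) (flatSort π.obj (i.obj s).sort)),
    ∀ N : Model T₀, ∃ h : ∀ s, N.carrier s ≃ (i.res (π.res N)).carrier s,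
      (∀ s x y, h s x = y ↔ (η s).Realize N.toStruc
        (pair (fun _ => x) (flatten (obj := π.obj) (Γ := (i.obj s).sort) y.1))) ∧
      (∀ (a : List L₀.Sorts) (s : L₀.Sorts) (f : L₀.Fun a s) (x : Tuple N.toStruc a.get),
        h s (N.funMap f x) = (i.res (π.res N)).funMap f (fun k => h _ (x k))) ∧
      ∀ (a : List L₀.Sorts) (R : L₀.Rel a) (x : Tuple N.toStruc a.get),
        N.relMap R x ↔ (i.res (π.res N)).relMap R (fun k => h _ (x k))

/-- `i` makes `T` an internal cover of `T₀`. -/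
def Interp.IsInternalCover {L₀ L : Lang.{u}} {T₀ : Theory L₀} {T : Theory L}
    (i : Interp T₀ T) : Prop :=
  i.StablyEmbedded ∧ ∃ π : Interp T T₀, π.StablyEmbedded ∧ π.CompIsId i

/-- A set `B₀` of elements of `M₀`, seen in `M`. An element of `M₀` is a tuple of elements of
`M`, and is replaced by its components. -/
def Interp.inj {L₀ L : Lang.{u}} {T₀ : Theory L₀} {T : Theory L} (i : Interp T₀ T) (M : Model T)
    (B₀ : Subsets (i.res M).toStruc) : Subsets M.toStruc := fun s =>
  {b | ∃ (s₀ : L₀.Sorts) (x : (i.obj s₀).pts M.toStruc), x ∈ B₀ s₀ ∧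
    ∃ j, (⟨(i.obj s₀).sort j, x.1 j⟩ : Σ t, M.carrier t) = ⟨s, b⟩}

/-- `A₀`: the elements of `M₀` that lie in `A` (all of whose components lie in `A`). -/
def Interp.restrict {L₀ L : Lang.{u}} {T₀ : Theory L₀} {T : Theory L} (i : Interp T₀ T)
    (M : Model T) (A : Subsets M.toStruc) : Subsets (i.res M).toStruc := fun s₀ =>
  {x : (i.obj s₀).pts M.toStruc | ∀ j, x.1 j ∈ A ((i.obj s₀).sort j)}

/-- `A ⊆ M` is a set of internality parameters: it is definably closed, and
`dcl(N₀ ∪ A) = N` for every model `N` of `T` that contains `A` (as a model of the theory of `M`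
with constants for `A`). -/
def Interp.IsInternalityParams {L₀ L : Lang.{u}} {T₀ : Theory L₀} {T : Theory L}
    (i : Interp T₀ T) (M : Model T) (A : Subsets M.toStruc) : Prop :=
  IsDefClosed M.toStruc A ∧
  ∀ (N : Model T) (j : ∀ s, A s → N.carrier s), IsElementary M.toStruc N.toStruc A j →
    ∀ s, dcl N.toStruc (fun t => i.inj N (fun _ => Set.univ) t ∪ Set.range (j t)) s = Set.univ

/-! ### Pro-groups -/

/-- A definable group in `T`: a definable set, with a group structure on its points in each
model of `T`, whose multiplication is given by one formula. -/
structure DefGroup {L : Lang.{u}} (T : Theory L) extends DefSet L where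
  group : ∀ M : Model T, Group (toDefSet.pts M.toStruc)
  mul_def : ∃ μ : Formula L (Sum.elim (Sum.elim sort sort) sort),
    ∀ (M : Model T) (x y z : toDefSet.pts M.toStruc),
      (group M).mul x y = z ↔ μ.Realize M.toStruc (pair (pair x.1 y.1) z.1)

/-- The group `G(M)`. -/
def DefGroup.pts {L : Lang.{u}} {T : Theory L} (G : DefGroup T) (M : Model T) : Type u :=
  G.toDefSet.pts M.toStruc

instance {L : Lang.{u}} {T : Theory L} (G : DefGroup T) (M : Model T) : Group (G.pts M) :=
  G.group M

/-- A pro-group in `T`: an inverse system, over a directed set, of definable groups and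
definable homomorphisms. -/
structure ProGroup {L : Lang.{u}} (T : Theory L) where
  I : Type u
  [preorder : Preorder I]
  [nonempty : Nonempty I]
  directed : ∀ i j : I, ∃ k, i ≤ k ∧ j ≤ k
  grp : I → DefGroup T
  map : ∀ {i j : I}, i ≤ j → ∀ M : Model T, (grp j).pts M →* (grp i).pts M
  map_def : ∀ {i j : I} (h : i ≤ j), ∃ φ : Formula L (Sum.elim (grp j).sort (grp i).sort),
    ∀ (M : Model T) (x : (grp j).pts M) (y : (grp i).pts M),
      map h M x = y ↔ φ.Realize M.toStruc (pair x.1 y.1)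
  map_id : ∀ (i : I) (M : Model T) (x : (grp i).pts M), map le_rfl M x = x
  map_comp : ∀ {i j k : I} (h : i ≤ j) (h' : j ≤ k) (M : Model T) (x : (grp k).pts M),
    map h M (map h' M x) = map (h.trans h') M x

attribute [instance] ProGroup.preorder ProGroup.nonempty

/-- The group `G(M)`, the inverse limit of the groups `Gᵢ(M)`. -/
def ProGroup.pts {L : Lang.{u}} {T : Theory L} (G : ProGroup T) (M : Model T) :
    Subgroup (∀ i, (G.grp i).pts M) where
  carrier := {g | ∀ (i j : G.I) (h : i ≤ j), G.map h M (g j) = g i}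
  one_mem' := fun i j h => map_one (G.map h M)
  mul_mem' := by
    intro a b ha hb i j h
    rw [Pi.mul_apply, map_mul, ha i j h, hb i j h, Pi.mul_apply]
  inv_mem' := by
    intro a ha i j h
    rw [Pi.inv_apply, map_inv, ha i j h, Pi.inv_apply]

/-- A definable action of a pro-group on every definable set `Q`: the action on `Q` is a
definable action of one of the groups of the system, `G (idx Q)`. -/
structure ProGroup.Action {L : Lang.{u}} {T : Theory L} (G : ProGroup T) where
  idx : DefSet L → G.I
  act : ∀ (Q : DefSet L) (M : Model T), MulAction ((G.grp (idx Q)).pts M) (Q.pts M.toStruc)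
  act_def : ∀ Q : DefSet L,
    ∃ φ : Formula L (Sum.elim (Sum.elim (G.grp (idx Q)).sort Q.sort) Q.sort),
      ∀ (M : Model T) (g : (G.grp (idx Q)).pts M) (x y : Q.pts M.toStruc),
        (act Q M).smul g x = y ↔ φ.Realize M.toStruc (pair (pair g.1 x.1) y.1)

/-- The action of `g ∈ G(M)` on `Q(M)`. -/
def ProGroup.Action.apply {L : Lang.{u}} {T : Theory L} {G : ProGroup T} (m : G.Action)
    {M : Model T} (g : G.pts M) (Q : DefSet L) (x : Q.pts M.toStruc) : Q.pts M.toStruc :=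
  (m.act Q M).smul (g.1 (m.idx Q)) x

/-- `G(B) = Aut(B/F)` through the action: the `g ∈ G(M)` whose coordinates `gᵢ ∈ Gᵢ(M)` lie
in `B` form a group, and there is an isomorphism from this group to `Aut(B/F)` under which `g`
corresponds to the automorphism of `B` (acting on tuples componentwise) induced by the action
of `g` on each `Q(M)`. -/
def ProGroup.Action.IdentifiesWithAut {L : Lang.{u}} {T : Theory L} {G : ProGroup T}
    (m : G.Action) (M : Model T) (B F : Subsets M.toStruc) : Prop :=
  ∃ GB : Subgroup (G.pts M),
    (∀ g : G.pts M, g ∈ GB ↔ ∀ i j, (g.1 i).1 j ∈ B ((G.grp i).sort j)) ∧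
    ∃ e : GB ≃* autGroup M.toStruc B F,
      ∀ (g : GB) (Q : DefSet L) (x : Q.pts M.toStruc) (hx : ∀ j, x.1 j ∈ B (Q.sort j)) (j : Q.ι),
        (m.apply g.1 Q x).1 j = ((e g).1 (Q.sort j) ⟨x.1 j, hx j⟩).1

/-- `G`, with the action `m`, is the Galois pro-group of the cover: `G(M) = Aut(M/M₀)`, through
the action, for every model `M` of `T`. -/
def ProGroup.Action.IsGalois {L₀ L : Lang.{u}} {T₀ : Theory L₀} {T : Theory L} {G : ProGroup T}
    (m : G.Action) (i : Interp T₀ T) : Prop :=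
  ∀ M : Model T, m.IdentifiesWithAut M (fun _ => Set.univ) (i.inj M (fun _ => Set.univ))

end ManySorted

/-!
An automorphism of `M` over `M₀` is determined by its values on `A`, because `dcl(M₀ ∪ A) = M`;
this gives injectivity.

For surjectivity, let `σ ∈ Aut(B/B₀)`. By stable embeddedness and elimination of imaginaries, the
fibre `φ(a, M₀)` of a formula `φ` over a tuple `a` of `A` has a code in `M₀`. The code is definable
over `a`, so it lies in `A₀` and is fixed by `σ`; hence `A` and `σ(A)` have the same type over `M₀`.
As each of them generates `M` over `M₀`, the restriction of `σ` to `A` extends to an element of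
`Aut(M/M₀) = G(M)`, given by some `g`.

The coordinates of `g` lie in `B` by a compactness argument in the style of Beth's theorem: in an
elementary extension of `M`, a point of `G` that acts on `A` as `g` does equals `g`, so `g` is
implicitly, hence explicitly, definable over `A ∪ σ(A) ⊆ B`.
-/

namespace ManySorted

section

theorem map_pair {S : Type u} {ι κ : Type*} {Γ : ι → S} {Δ : κ → S} {M N : S → Type*}
    (f : ∀ s, M s → N s) (x : Tuple M Γ) (y : Tuple M Δ) :
    (fun c => f _ (pair x y c)) = pair (fun a => f _ (x a)) fun b => f _ (y b) := by
  funext c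
  cases c <;> rfl

variable {L : Lang.{u}} {α β γ : Type*} {Γ : α → L.Sorts} {Δ : β → L.Sorts} {Θ : γ → L.Sorts}

/-! ### Substitution -/

/-- Weakening of a term by a new innermost bound variable. -/
def Term.shift {l : List L.Sorts} (s : L.Sorts) :
    ∀ {t : L.Sorts}, Term L Γ l t → Term L Γ (s :: l) t
  | _, .free a => .free a
  | _, .bound k => .bound (Δ := s :: l) k.succ
  | _, .app f ts => .app f fun k => (ts k).shift s

/-- Simultaneous substitution of terms for the free and the bound variables of a term. -/
def Term.subst {l l' : List L.Sorts} (ρ : ∀ a, Term L Δ l' (Γ a))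
    (τ : ∀ k, Term L Δ l' (l.get k)) : ∀ {t : L.Sorts}, Term L Γ l t → Term L Δ l' t
  | _, .free a => ρ a
  | _, .bound k => τ k
  | _, .app f ts => .app f fun k => (ts k).subst ρ τ

/-- The substitution for the bound variables that results from `τ` under one more quantifier. -/
def Term.liftBound {l l' : List L.Sorts} (τ : ∀ k, Term L Γ l' (l.get k)) (s : L.Sorts) :
    ∀ k, Term L Γ (s :: l') ((s :: l).get k)
  | ⟨0, _⟩ => .bound (Δ := s :: l') ⟨0, Nat.succ_pos _⟩
  | ⟨k + 1, h⟩ => (τ ⟨k, Nat.lt_of_succ_lt_succ h⟩).shift s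

/-- Simultaneous substitution of terms for the free and the bound variables of a formula. -/
def BForm.subst : ∀ {l l' : List L.Sorts} (_ : ∀ a, Term L Δ l' (Γ a))
    (_ : ∀ k, Term L Δ l' (l.get k)), BForm L Γ l → BForm L Δ l'
  | _, _, _, _, .falsum => .falsum
  | _, _, ρ, τ, .eq t₁ t₂ => .eq (t₁.subst ρ τ) (t₂.subst ρ τ)
  | _, _, ρ, τ, .rel R ts => .rel R fun k => (ts k).subst ρ τ
  | _, _, ρ, τ, .imp φ ψ => .imp (φ.subst ρ τ) (ψ.subst ρ τ)
  | _, _, ρ, τ, .all s φ => .all s (φ.subst (fun a => (ρ a).shift s) (Term.liftBound τ s))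

theorem Term.val_shift {l : List L.Sorts} {s t : L.Sorts} (M : Struc L) (x : Tuple M Γ)
    (e : Tuple M l.get) (b : M s) (r : Term L Γ l t) :
    (r.shift s).val M x (consTuple b e) = r.val M x e := by
  induction r with
  | free a => rfl
  | bound k => rfl
  | app f ts ih => exact congrArg (M.funMap f) (funext ih)

theorem Term.val_subst {l l' : List L.Sorts} {t : L.Sorts} (M : Struc L)
    (ρ : ∀ a, Term L Δ l' (Γ a)) (τ : ∀ k, Term L Δ l' (l.get k)) (x : Tuple M Δ)
    (e : Tuple M l'.get) (r : Term L Γ l t) :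
    (r.subst ρ τ).val M x e = r.val M (fun a => (ρ a).val M x e) fun k => (τ k).val M x e := by
  induction r with
  | free a => rfl
  | bound k => rfl
  | app f ts ih => exact congrArg (M.funMap f) (funext ih)

theorem Term.val_liftBound {l l' : List L.Sorts} {s : L.Sorts} (M : Struc L)
    (τ : ∀ k, Term L Γ l' (l.get k)) (x : Tuple M Γ) (e : Tuple M l'.get) (b : M s) :
    (fun k => (Term.liftBound τ s k).val M x (consTuple b e)) =
      consTuple b fun k => (τ k).val M x e := by
  funext ⟨k, h⟩
  cases k with
  | zero => rfl
  | succ k => exact Term.val_shift M x e b _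

theorem BForm.holds_subst {l l' : List L.Sorts} (M : Struc L) (φ : BForm L Γ l)
    (ρ : ∀ a, Term L Δ l' (Γ a)) (τ : ∀ k, Term L Δ l' (l.get k)) (x : Tuple M Δ)
    (e : Tuple M l'.get) : (φ.subst ρ τ).Holds M x e ↔
      φ.Holds M (fun a => (ρ a).val M x e) fun k => (τ k).val M x e := by
  induction φ generalizing l' with
  | falsum => rfl
  | eq t₁ t₂ => simp only [BForm.subst, BForm.Holds, Term.val_subst]
  | rel R ts => simp only [BForm.subst, BForm.Holds, Term.val_subst]
  | imp φ ψ ihφ ihψ => simp only [BForm.subst, BForm.Holds, ihφ, ihψ]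
  | all s φ ih => simp only [BForm.subst, BForm.Holds, ih, Term.val_liftBound, Term.val_shift]

/-- The only family indexed by the positions of the empty list. -/
def nilPi {S : Type u} {F : S → Sort v} (k : Fin ([] : List S).length) : F (([] : List S).get k) :=
  Fin.elim0 k

theorem eq_nilPi {S : Type u} {F : S → Sort v}
    (e : ∀ k : Fin ([] : List S).length, F (([] : List S).get k)) : e = nilPi :=
  funext fun k => Fin.elim0 k

/-- A substitution: a family of terms of the sorts `Δ b` in the variables `Γ`. It maps
`Γ`-tuples to `Δ`-tuples. -/
abbrev Sub (L : Lang.{u}) {α β : Type*} (Γ : α → L.Sorts) (Δ : β → L.Sorts) : Type _ :=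
  ∀ b, Term L Γ [] (Δ b)

namespace Sub

/-- The map of tuples defined by a substitution. -/
def eval (M : Struc L) (ρ : Sub L Γ Δ) (x : Tuple M Γ) : Tuple M Δ :=
  fun b => (ρ b).val M x nilPi

/-- The first projection. -/
def fst : Sub L (Sum.elim Γ Δ) Γ := fun a => .free (Γ := Sum.elim Γ Δ) (Sum.inl a)

/-- The second projection. -/
def snd : Sub L (Sum.elim Γ Δ) Δ := fun b => .free (Γ := Sum.elim Γ Δ) (Sum.inr b)

/-- The identity substitution. -/
def id : Sub L Γ Γ := fun a => .free a

/-- The substitution into a concatenated context with the given components. -/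
def pair (ρ : Sub L Θ Γ) (τ : Sub L Θ Δ) : Sub L Θ (Sum.elim Γ Δ)
  | Sum.inl a => ρ a
  | Sum.inr b => τ b

/-- The composition of substitutions. -/
def comp (ρ : Sub L Δ Θ) (τ : Sub L Γ Δ) : Sub L Γ Θ := fun c => (ρ c).subst τ nilPi

@[simp] theorem eval_fst (M : Struc L) (x : Tuple M Γ) (y : Tuple M Δ) :
    (fst : Sub L (Sum.elim Γ Δ) Γ).eval M (ManySorted.pair x y) = x := rfl

@[simp] theorem eval_snd (M : Struc L) (x : Tuple M Γ) (y : Tuple M Δ) :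
    (snd : Sub L (Sum.elim Γ Δ) Δ).eval M (ManySorted.pair x y) = y := rfl

@[simp] theorem eval_id (M : Struc L) (x : Tuple M Γ) : (id : Sub L Γ Γ).eval M x = x := rfl

@[simp] theorem eval_pair (M : Struc L) (ρ : Sub L Θ Γ) (τ : Sub L Θ Δ) (x : Tuple M Θ) :
    (pair ρ τ).eval M x = ManySorted.pair (ρ.eval M x) (τ.eval M x) := by
  funext c
  cases c <;> rfl

@[simp] theorem eval_comp (M : Struc L) (ρ : Sub L Δ Θ) (τ : Sub L Γ Δ) (x : Tuple M Γ) :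
    (comp ρ τ).eval M x = ρ.eval M (τ.eval M x) := by
  funext c
  refine (Term.val_subst M τ nilPi x _ (ρ c)).trans ?_
  exact congrArg ((ρ c).val M _) (eq_nilPi _)

theorem exists_eval_comp {f : γ → α} (hf : f.Surjective) : ∃ ρ : Sub L (fun c => Γ (f c)) Γ,
    ∀ (M : Struc L) (x : Tuple M Γ), (ρ.eval M fun c => x (f c)) = x := by
  have hvar (a : α) : ∃ t : Term L (fun c => Γ (f c)) [] (Γ a), ∀ (M : Struc L) (x : Tuple M Γ),
      t.val M (fun c => x (f c)) nilPi = x a := by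
    obtain ⟨c, rfl⟩ := hf a
    exact ⟨.free (Γ := fun c => Γ (f c)) c, fun _ _ => rfl⟩
  choose ρ hρ using hvar
  exact ⟨ρ, fun M x => funext fun a => hρ a M x⟩

end Sub

/-! ### Operations on formulas -/

namespace Formula

/-- The formula `φ(ρ(x))`. -/
def sub (φ : Formula L Δ) (ρ : Sub L Γ Δ) : Formula L Γ := BForm.subst ρ nilPi φ

@[simp] theorem realize_sub (M : Struc L) (φ : Formula L Δ) (ρ : Sub L Γ Δ) (x : Tuple M Γ) :
    (φ.sub ρ).Realize M x ↔ φ.Realize M (ρ.eval M x) := by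
  refine (BForm.holds_subst M φ ρ _ x _).trans ?_
  exact iff_of_eq (congrArg (BForm.Holds M _ φ) (eq_nilPi _))

/-- Implication. -/
def imp (φ ψ : Formula L Γ) : Formula L Γ := BForm.imp φ ψ

/-- Falsity. -/
def bot : Formula L Γ := BForm.falsum

/-- Negation. -/
def not (φ : Formula L Γ) : Formula L Γ := imp φ bot

/-- Truth. -/
def top : Formula L Γ := not bot

/-- Conjunction. -/
def and (φ ψ : Formula L Γ) : Formula L Γ := not (imp φ (not ψ))

/-- Equivalence. -/
def iff (φ ψ : Formula L Γ) : Formula L Γ := and (imp φ ψ) (imp ψ φ)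

/-- Equality of terms. -/
def eq {s : L.Sorts} (t₁ t₂ : Term L Γ [] s) : Formula L Γ := BForm.eq t₁ t₂

@[simp] theorem realize_imp (M : Struc L) (φ ψ : Formula L Γ) (x : Tuple M Γ) :
    (imp φ ψ).Realize M x ↔ (φ.Realize M x → ψ.Realize M x) := Iff.rfl

@[simp] theorem realize_bot (M : Struc L) (x : Tuple M Γ) :
    (bot : Formula L Γ).Realize M x ↔ False := Iff.rfl

@[simp] theorem realize_not (M : Struc L) (φ : Formula L Γ) (x : Tuple M Γ) :
    (not φ).Realize M x ↔ ¬ φ.Realize M x := Iff.rfl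

@[simp] theorem realize_top (M : Struc L) (x : Tuple M Γ) :
    (top : Formula L Γ).Realize M x ↔ True := by simp [top]

@[simp] theorem realize_and (M : Struc L) (φ ψ : Formula L Γ) (x : Tuple M Γ) :
    (and φ ψ).Realize M x ↔ φ.Realize M x ∧ ψ.Realize M x := by simp [and]

@[simp] theorem realize_iff (M : Struc L) (φ ψ : Formula L Γ) (x : Tuple M Γ) :
    (iff φ ψ).Realize M x ↔ (φ.Realize M x ↔ ψ.Realize M x) := by
  simp [iff, iff_iff_implies_and_implies]

@[simp] theorem realize_eq (M : Struc L) {s : L.Sorts} (t₁ t₂ : Term L Γ [] s) (x : Tuple M Γ) :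
    (eq t₁ t₂).Realize M x ↔ t₁.val M x nilPi = t₂.val M x nilPi := Iff.rfl

/-- `φ` can be universally quantified over its variables `Δ`. -/
def IsQuantifiable (φ : Formula L (Sum.elim Γ Δ)) : Prop :=
  ∃ ψ : Formula L Γ, ∀ (M : Struc L) (x : Tuple M Γ),
    ψ.Realize M x ↔ ∀ y : Tuple M Δ, φ.Realize M (pair x y)

theorem isQuantifiable_unit {s : L.Sorts} (φ : Formula L (Sum.elim Γ fun _ : Unit => s)) :
    φ.IsQuantifiable := by
  let ρ : ∀ a, Term L Γ [s] (Sum.elim Γ (fun _ : Unit => s) a) := fun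
    | Sum.inl a => .free a
    | Sum.inr _ => .bound (Δ := [s]) ⟨0, Nat.succ_pos _⟩
  have hρ (M : Struc L) (x : Tuple M Γ) (b : M s) :
      (fun a => (ρ a).val M x (consTuple b nilPi)) = pair x fun _ : Unit => b := by
    funext a
    cases a <;> rfl
  have holds_ρ (M : Struc L) (x : Tuple M Γ) (b : M s) :
      (BForm.subst ρ nilPi φ).Holds M x (consTuple b nilPi) ↔
        φ.Realize M (pair x fun _ : Unit => b) := by
    rw [BForm.holds_subst, hρ]
    exact iff_of_eq (congrArg (BForm.Holds M _ φ) (eq_nilPi _))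
  exact ⟨BForm.all s (BForm.subst ρ nilPi φ), fun M x =>
    (forall_congr' (holds_ρ M x)).trans ⟨fun h y => h (y ()), fun h b => h fun _ => b⟩⟩

theorem isQuantifiable_isEmpty [IsEmpty β] (φ : Formula L (Sum.elim Γ Δ)) :
    φ.IsQuantifiable := by
  refine ⟨φ.sub (Sub.pair Sub.id isEmptyElim), fun M x => ?_⟩
  rw [realize_sub, Sub.eval_pair, Sub.eval_id]
  exact ⟨fun h y => Subsingleton.elim (α := Tuple M Δ) _ y ▸ h, fun h => h _⟩

theorem isQuantifiable_option {Δ : Option β → L.Sorts}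
    (ih : ∀ φ : Formula L (Sum.elim Γ fun k => Δ (some k)), φ.IsQuantifiable)
    (φ : Formula L (Sum.elim Γ Δ)) : φ.IsQuantifiable := by
  let ρ : Sub L (Sum.elim (Sum.elim Γ fun k => Δ (some k)) fun _ : Unit => Δ none)
      (Sum.elim Γ Δ) := fun
    | Sum.inl a => Sub.fst.comp Sub.fst a
    | Sum.inr none => Sub.snd ()
    | Sum.inr (some k) => Sub.snd.comp Sub.fst k
  have hρ (M : Struc L) (x : Tuple M Γ) (y : Tuple M Δ) :
      ρ.eval M (pair (pair x fun k => y (some k)) fun _ => y none) = pair x y := by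
    funext a
    rcases a with a | _ | k <;> rfl
  obtain ⟨ψ, hψ⟩ := isQuantifiable_unit (φ.sub ρ)
  obtain ⟨χ, hχ⟩ := ih ψ
  refine ⟨χ, fun M x => ?_⟩
  simp only [hχ, hψ, realize_sub]
  refine ⟨fun h y => hρ M x y ▸ h _ _, fun h y b => ?_⟩
  exact (hρ M x fun | none => b () | some k => y k) ▸ h _

theorem isQuantifiable_of_equiv (e : γ ≃ β)
    (ih : ∀ φ : Formula L (Sum.elim Γ fun k => Δ (e k)), φ.IsQuantifiable)
    (φ : Formula L (Sum.elim Γ Δ)) : φ.IsQuantifiable := by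
  obtain ⟨ρ, hρ⟩ := Sub.exists_eval_comp (Γ := Δ) e.surjective
  obtain ⟨ψ, hψ⟩ := ih (φ.sub (Sub.pair Sub.fst (ρ.comp Sub.snd)))
  refine ⟨ψ, fun M x => (hψ M x).trans ((e.piCongrLeft fun b => M (Δ b)).forall_congr fun y => ?_)⟩
  rw [realize_sub, Sub.eval_pair, Sub.eval_fst, Sub.eval_comp, Sub.eval_snd,
    ← hρ M (e.piCongrLeft _ y)]
  simp only [Equiv.piCongrLeft_apply_apply]

theorem isQuantifiable [Finite β] (φ : Formula L (Sum.elim Γ Δ)) : φ.IsQuantifiable := by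
  refine Finite.induction_empty_option (P := fun β => ∀ (Δ : β → L.Sorts)
    (φ : Formula L (Sum.elim Γ Δ)), φ.IsQuantifiable) ?_ ?_ ?_ β Δ φ
  · exact fun e ih Δ => isQuantifiable_of_equiv e (ih _)
  · exact fun _ => isQuantifiable_isEmpty
  · exact fun ih Δ => isQuantifiable_option (ih _)

/-- Universal quantification over a finite tuple of variables. -/
noncomputable def all [Finite β] (φ : Formula L (Sum.elim Γ Δ)) : Formula L Γ :=
  φ.isQuantifiable.choose

/-- Existential quantification over a finite tuple of variables. -/
noncomputable def ex [Finite β] (φ : Formula L (Sum.elim Γ Δ)) : Formula L Γ := not (all (not φ))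

@[simp] theorem realize_all [Finite β] (M : Struc L) (φ : Formula L (Sum.elim Γ Δ))
    (x : Tuple M Γ) : (all φ).Realize M x ↔ ∀ y : Tuple M Δ, φ.Realize M (pair x y) :=
  φ.isQuantifiable.choose_spec M x

@[simp] theorem realize_ex [Finite β] (M : Struc L) (φ : Formula L (Sum.elim Γ Δ))
    (x : Tuple M Γ) : (ex φ).Realize M x ↔ ∃ y : Tuple M Δ, φ.Realize M (pair x y) := by
  simp [ex]

/-- The conjunction of a finite family of formulas. -/
noncomputable def iAnd {τ : Type*} [Finite τ] (φ : τ → Formula L Γ) : Formula L Γ :=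
  have := Fintype.ofFinite τ
  (Finset.univ.toList.map φ).foldr and top

@[simp] theorem realize_iAnd {τ : Type*} [Finite τ] (M : Struc L) (φ : τ → Formula L Γ)
    (x : Tuple M Γ) : (iAnd φ).Realize M x ↔ ∀ t, (φ t).Realize M x := by
  have realize_foldr (l : List (Formula L Γ)) :
      (l.foldr and top).Realize M x ↔ ∀ ψ ∈ l, ψ.Realize M x := by
    induction l with
    | nil => simp
    | cons ψ l ih => simp [ih]
  simp [iAnd, realize_foldr]

/-- Equality of two finite tuples of terms. -/
noncomputable def eqTuple [Finite β] (ρ τ : Sub L Γ Δ) : Formula L Γ :=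
  iAnd fun b => eq (ρ b) (τ b)

@[simp] theorem realize_eqTuple [Finite β] (M : Struc L) (ρ τ : Sub L Γ Δ) (x : Tuple M Γ) :
    (eqTuple ρ τ).Realize M x ↔ ρ.eval M x = τ.eval M x := by
  simp [eqTuple, funext_iff, Sub.eval]

end Formula

end

/-! ### Finite support -/

section

variable {L : Lang.{u}} {α β γ : Type*} {Γ : α → L.Sorts} {Δ : β → L.Sorts} {Θ : γ → L.Sorts}

/-- `φ` is equivalent to a formula all of whose free variables lie in `S`. -/
def BForm.SupportedBy (S : Set α) {l : List L.Sorts} (φ : BForm L Γ l) : Prop :=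
  ∃ φ' : BForm L (fun a : S => Γ a) l, ∀ (M : Struc L) (x : Tuple M Γ) (e : Tuple M l.get),
    φ.Holds M x e ↔ φ'.Holds M (fun a : S => x a) e

theorem Term.exists_support {l : List L.Sorts} {s : L.Sorts} (t : Term L Γ l s) :
    ∃ S : Set α, S.Finite ∧ ∀ S', S ⊆ S' → ∃ t' : Term L (fun a : S' => Γ a) l s,
      ∀ (M : Struc L) (x : Tuple M Γ) (e : Tuple M l.get),
        t.val M x e = t'.val M (fun a : S' => x a) e := by
  induction t with
  | free a =>
    exact ⟨{a}, Set.finite_singleton a, fun S' h =>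
      ⟨.free (Γ := fun a : S' => Γ a) ⟨a, h rfl⟩, fun _ _ _ => rfl⟩⟩
  | bound k => exact ⟨∅, Set.finite_empty, fun _ _ => ⟨.bound k, fun _ _ _ => rfl⟩⟩
  | app f ts ih =>
    choose S hS h using ih
    refine ⟨⋃ k, S k, Set.finite_iUnion hS, fun S' hS' => ?_⟩
    choose t' ht' using fun k => h k S' ((Set.subset_iUnion S k).trans hS')
    exact ⟨.app f t', fun M x e => congrArg (M.funMap f) (funext fun k => ht' k M x e)⟩

theorem BForm.exists_supportedBy {l : List L.Sorts} (φ : BForm L Γ l) :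
    ∃ S : Set α, S.Finite ∧ ∀ S', S ⊆ S' → φ.SupportedBy S' := by
  induction φ with
  | falsum => exact ⟨∅, Set.finite_empty, fun _ _ => ⟨.falsum, fun _ _ _ => Iff.rfl⟩⟩
  | eq t₁ t₂ =>
    obtain ⟨S₁, hS₁, h₁⟩ := t₁.exists_support
    obtain ⟨S₂, hS₂, h₂⟩ := t₂.exists_support
    refine ⟨S₁ ∪ S₂, hS₁.union hS₂, fun S' hS' => ?_⟩
    obtain ⟨t₁', ht₁⟩ := h₁ S' (Set.subset_union_left.trans hS')
    obtain ⟨t₂', ht₂⟩ := h₂ S' (Set.subset_union_right.trans hS')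
    exact ⟨.eq t₁' t₂', fun M x e => by simp only [BForm.Holds, ht₁, ht₂]⟩
  | rel R ts =>
    choose S hS h using fun k => (ts k).exists_support
    refine ⟨⋃ k, S k, Set.finite_iUnion hS, fun S' hS' => ?_⟩
    choose t' ht' using fun k => h k S' ((Set.subset_iUnion S k).trans hS')
    exact ⟨.rel R t', fun M x e => by simp only [BForm.Holds, ht']⟩
  | imp φ ψ ihφ ihψ =>
    obtain ⟨S₁, hS₁, h₁⟩ := ihφ
    obtain ⟨S₂, hS₂, h₂⟩ := ihψ
    refine ⟨S₁ ∪ S₂, hS₁.union hS₂, fun S' hS' => ?_⟩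
    obtain ⟨φ', hφ'⟩ := h₁ S' (Set.subset_union_left.trans hS')
    obtain ⟨ψ', hψ'⟩ := h₂ S' (Set.subset_union_right.trans hS')
    exact ⟨.imp φ' ψ', fun M x e => by simp only [BForm.Holds, hφ', hψ']⟩
  | all s φ ih =>
    obtain ⟨S, hS, h⟩ := ih
    refine ⟨S, hS, fun S' hS' => ?_⟩
    obtain ⟨φ', hφ'⟩ := h S' hS'
    exact ⟨.all s φ', fun M x e => forall_congr' fun b => hφ' M x _⟩

theorem Formula.exists_support (φ : Formula L Γ) :
    ∃ (ι : Type) (_ : Finite ι) (f : ι → α) (φ' : Formula L fun k => Γ (f k)),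
      ∀ (M : Struc L) (x : Tuple M Γ), φ.Realize M x ↔ φ'.Realize M fun k => x (f k) := by
  obtain ⟨S, hS, h⟩ := BForm.exists_supportedBy φ
  obtain ⟨φ', hφ'⟩ := h S subset_rfl
  have := hS.to_subtype
  obtain ⟨n, ⟨e⟩⟩ := Finite.exists_equiv_fin S
  obtain ⟨ρ, hρ⟩ := Sub.exists_eval_comp (Γ := fun a : S => Γ a) e.symm.surjective
  refine ⟨Fin n, inferInstance, fun k => e.symm k, Formula.sub φ' ρ, fun M x => ?_⟩
  rw [realize_sub, hρ M fun a : S => x a]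
  exact hφ' M x _

theorem Formula.exists_support_pair (φ : Formula L (Sum.elim Γ Δ)) :
    ∃ (ι κ : Type) (_ : Finite ι) (_ : Finite κ) (f : ι → α) (g : κ → β)
      (φ' : Formula L (Sum.elim (fun k => Γ (f k)) fun k => Δ (g k))),
      ∀ (M : Struc L) (x : Tuple M Γ) (y : Tuple M Δ), φ.Realize M (pair x y) ↔
        φ'.Realize M (pair (fun k => x (f k)) fun k => y (g k)) := by
  obtain ⟨S, hS, h⟩ := BForm.exists_supportedBy φ
  obtain ⟨φ', hφ'⟩ := h S subset_rfl
  let S₁ : Set α := Sum.inl ⁻¹' S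
  let S₂ : Set β := Sum.inr ⁻¹' S
  have := (hS.preimage Sum.inl_injective.injOn : S₁.Finite).to_subtype
  have := (hS.preimage Sum.inr_injective.injOn : S₂.Finite).to_subtype
  obtain ⟨m, ⟨e₁⟩⟩ := Finite.exists_equiv_fin S₁
  obtain ⟨n, ⟨e₂⟩⟩ := Finite.exists_equiv_fin S₂
  obtain ⟨ρ₁, hρ₁⟩ := Sub.exists_eval_comp (Γ := fun a : S₁ => Γ a) e₁.symm.surjective
  obtain ⟨ρ₂, hρ₂⟩ := Sub.exists_eval_comp (Γ := fun b : S₂ => Δ b) e₂.symm.surjective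
  let ρ : Sub L (Sum.elim (fun a : S₁ => Γ a) fun b : S₂ => Δ b)
      (fun c : S => Sum.elim Γ Δ c) := fun
    | ⟨Sum.inl a, ha⟩ => Sub.fst (Γ := fun a : S₁ => Γ a) ⟨a, ha⟩
    | ⟨Sum.inr b, hb⟩ => Sub.snd (Δ := fun b : S₂ => Δ b) ⟨b, hb⟩
  have hρ (M : Struc L) (x : Tuple M Γ) (y : Tuple M Δ) :
      ρ.eval M (pair (fun a : S₁ => x a) fun b : S₂ => y b) = fun c : S => pair x y c := by
    funext ⟨c, hc⟩
    cases c <;> rfl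
  refine ⟨Fin m, Fin n, inferInstance, inferInstance, fun k => e₁.symm k, fun k => e₂.symm k,
    Formula.sub φ' (ρ.comp (Sub.pair (ρ₁.comp Sub.fst) (ρ₂.comp Sub.snd))), fun M x y => ?_⟩
  simp only [realize_sub, Sub.eval_comp, Sub.eval_pair, Sub.eval_fst, Sub.eval_snd]
  rw [hρ₁ M fun a : S₁ => x a, hρ₂ M fun b : S₂ => y b, hρ]
  exact hφ' M (pair x y) _

theorem Formula.exists_support_left (φ : Formula L (Sum.elim Γ Δ)) :
    ∃ (ι : Type) (_ : Finite ι) (f : ι → α) (φ' : Formula L (Sum.elim (fun k => Γ (f k)) Δ)),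
      ∀ (M : Struc L) (x : Tuple M Γ) (y : Tuple M Δ), φ.Realize M (pair x y) ↔
        φ'.Realize M (pair (fun k => x (f k)) y) := by
  obtain ⟨ι, κ, _, _, f, g, φ', hφ'⟩ := φ.exists_support_pair
  refine ⟨ι, inferInstance, f, φ'.sub (Sub.pair Sub.fst fun k => Sub.snd (g k)), fun M x y => ?_⟩
  rw [hφ', realize_sub, Sub.eval_pair]
  rfl

theorem Formula.exists_support_right (φ : Formula L (Sum.elim Γ Δ)) :
    ∃ (S : Set β) (_ : Finite S) (φ' : Formula L (Sum.elim Γ fun b : S => Δ b)),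
      ∀ (M : Struc L) (x : Tuple M Γ) (y : Tuple M Δ), φ.Realize M (pair x y) ↔
        φ'.Realize M (pair x fun b : S => y b) := by
  obtain ⟨S, hS, h⟩ := BForm.exists_supportedBy φ
  obtain ⟨φ', hφ'⟩ := h S subset_rfl
  let ρ : Sub L (Sum.elim Γ fun b : Sum.inr ⁻¹' S => Δ b) (fun c : S => Sum.elim Γ Δ c) := fun
    | ⟨Sum.inl a, _⟩ => Sub.fst a
    | ⟨Sum.inr b, hb⟩ => Sub.snd (Δ := fun b : Sum.inr ⁻¹' S => Δ b) ⟨b, hb⟩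
  have hρ (M : Struc L) (x : Tuple M Γ) (y : Tuple M Δ) :
      ρ.eval M (pair x fun b : Sum.inr ⁻¹' S => y b) = fun c : S => pair x y c := by
    funext ⟨c, hc⟩
    cases c <;> rfl
  refine ⟨_, (hS.preimage Sum.inr_injective.injOn).to_subtype, Formula.sub φ' ρ, fun M x y => ?_⟩
  rw [realize_sub, hρ]
  exact hφ' M (pair x y) _

/-! ### Types and definable closure -/

/-- The tuples `x` of `M` and `y` of `N` satisfy the same formulas. -/
def SameType (M N : Struc L) (x : Tuple M Γ) (y : Tuple N Γ) : Prop :=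
  ∀ φ : Formula L Γ, φ.Realize M x ↔ φ.Realize N y

/-- The tuple `b` is definable over the tuple `c`: some formula with the parameters `c` has `b`
as its only solution. -/
def IsDefinableOver (M : Struc L) (c : Tuple M Γ) (b : Tuple M Δ) : Prop :=
  ∃ φ : Formula L (Sum.elim Γ Δ), ∀ y : Tuple M Δ, φ.Realize M (pair c y) ↔ y = b

/-- The elements of `B` as one tuple, indexed by themselves. -/
abbrev Subsets.enum {M : Struc L} (B : Subsets M) : Tuple M fun a : Σ t, B t => a.1 :=
  fun a => a.2.1

section Types

variable {M N : Struc L}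

theorem SameType.symm {x : Tuple M Γ} {y : Tuple N Γ} (h : SameType M N x y) :
    SameType N M y x := fun φ => (h φ).symm

theorem SameType.sub {x : Tuple M Γ} {y : Tuple N Γ} (h : SameType M N x y) (ρ : Sub L Γ Δ) :
    SameType M N (ρ.eval M x) (ρ.eval N y) := fun φ => by
  simpa only [Formula.realize_sub] using h (φ.sub ρ)

theorem mem_dcl_iff {B : Subsets M} {s : L.Sorts} {b : M s} :
    b ∈ dcl M B s ↔ IsDefinableOver M B.enum fun _ : Unit => b :=
  exists_congr fun _ => ⟨fun h y => (h (y ())).trans ⟨fun h => funext fun _ => h,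
    fun h => congrFun h ()⟩, fun h y => (h fun _ => y).trans ⟨fun h => congrFun h (),
    fun h => funext fun _ => h⟩⟩

theorem IsDefinableOver.component [Finite β] {c : Tuple M Γ} {b : Tuple M Δ}
    (h : IsDefinableOver M c b) (k : β) : IsDefinableOver M c fun _ : Unit => b k := by
  obtain ⟨φ, hφ⟩ := h
  refine ⟨Formula.ex ((φ.sub (Sub.pair (Sub.fst.comp Sub.fst) Sub.snd)).and
    (Formula.eq (Sub.snd.comp Sub.fst ()) (Sub.snd (Δ := Δ) k))), fun y => ?_⟩
  simp only [Formula.realize_ex, Formula.realize_and, Formula.realize_sub, Sub.eval_pair,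
    Sub.eval_comp, Sub.eval_fst, Sub.eval_snd, hφ, exists_eq_left]
  exact ⟨fun h => funext fun _ => h, fun h => congrFun h ()⟩

theorem IsDefinableOver.of_components [Finite β] {c : Tuple M Γ} {b : Tuple M Δ}
    (h : ∀ k, IsDefinableOver M c fun _ : Unit => b k) : IsDefinableOver M c b := by
  choose φ hφ using h
  refine ⟨Formula.iAnd fun k => (φ k).sub (Sub.pair Sub.fst fun _ => Sub.snd k), fun y => ?_⟩
  simp only [Formula.realize_iAnd, Formula.realize_sub, Sub.eval_pair, Sub.eval_fst, hφ]
  exact ⟨fun h => funext fun k => congrFun (h k) (), fun h k => funext fun _ => congrFun h k⟩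

theorem IsDefinableOver.trans {c : Tuple M Γ} {b : Tuple M Δ} {d : Tuple M Θ}
    (hb : ∀ k, IsDefinableOver M c fun _ : Unit => b k) (hd : IsDefinableOver M b d) :
    IsDefinableOver M c d := by
  obtain ⟨φ, hφ⟩ := hd
  obtain ⟨ι, _, f, φ', hφ'⟩ := φ.exists_support_left
  obtain ⟨ψ, hψ⟩ := IsDefinableOver.of_components (b := fun k => b (f k)) fun k => hb (f k)
  refine ⟨Formula.ex ((ψ.sub (Sub.pair (Sub.fst.comp Sub.fst) Sub.snd)).and
    (φ'.sub (Sub.pair Sub.snd (Sub.snd.comp Sub.fst)))), fun y => ?_⟩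
  simp only [Formula.realize_ex, Formula.realize_and, Formula.realize_sub, Sub.eval_pair,
    Sub.eval_comp, Sub.eval_fst, Sub.eval_snd, hψ, exists_eq_left, ← hφ', hφ]

theorem isDefinableOver_component (c : Tuple M Γ) (a : α) :
    IsDefinableOver M c fun _ : Unit => c a :=
  ⟨Formula.eq (Sub.snd ()) (Sub.fst a), fun _ =>
    ⟨fun h => funext fun _ => h, fun h => congrFun h ()⟩⟩

theorem subset_dcl (B : Subsets M) : B ≤ dcl M B := fun s b hb =>
  mem_dcl_iff.2 (isDefinableOver_component B.enum ⟨s, b, hb⟩)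

theorem dcl_mono_of_le_dcl {B C : Subsets M} (h : B ≤ dcl M C) : dcl M B ≤ dcl M C :=
  fun _ _ hb => mem_dcl_iff.2 <|
    .trans (fun k => mem_dcl_iff.1 (h k.1 k.2.2)) (mem_dcl_iff.1 hb)

theorem isDefClosed_dcl (B : Subsets M) : IsDefClosed M (dcl M B) := dcl_mono_of_le_dcl le_rfl

theorem IsDefClosed.mem_of_isDefinableOver [Finite β] {B : Subsets M} (hB : IsDefClosed M B)
    {c : Tuple M Γ} (hc : ∀ a, c a ∈ B (Γ a)) {b : Tuple M Δ} (h : IsDefinableOver M c b) (k : β) :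
    b k ∈ B (Δ k) :=
  hB _ <| mem_dcl_iff.2 <|
    .trans (fun a => isDefinableOver_component B.enum ⟨_, c a, hc a⟩) (h.component k)

end Types

end

/-! ### Tuples of the same type -/

section

variable {L : Lang.{u}} {α β : Type*} {Γ : α → L.Sorts} {Δ : β → L.Sorts} {M N : Struc L}

instance (X : DefSet L) : Finite X.ι := X.fin

theorem SameType.isolates [Finite β] {c : Tuple M Γ} {b : Tuple M Δ} {c' : Tuple N Γ}
    {b' : Tuple N Δ} (h : SameType M N (pair c b) (pair c' b')) {φ : Formula L (Sum.elim Γ Δ)}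
    (hφ : ∀ y, φ.Realize M (pair c y) ↔ y = b) (y : Tuple N Δ) :
    φ.Realize N (pair c' y) ↔ y = b' := by
  have key := h (Formula.all ((φ.sub (Sub.pair (Sub.fst.comp Sub.fst) Sub.snd)).iff
    (Formula.eqTuple Sub.snd (Sub.snd.comp Sub.fst))))
  simp only [Formula.realize_all, Formula.realize_iff, Formula.realize_sub,
    Formula.realize_eqTuple, Sub.eval_pair, Sub.eval_comp, Sub.eval_fst, Sub.eval_snd] at key
  exact key.1 hφ y

theorem SameType.eq_of_isDefinableOver [Finite β] {c : Tuple M Γ} {b : Tuple M Δ}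
    {c' : Tuple N Γ} {b₁ b₂ : Tuple N Δ} (hb : IsDefinableOver M c b)
    (h₁ : SameType M N (pair c b) (pair c' b₁)) (h₂ : SameType M N (pair c b) (pair c' b₂)) :
    b₁ = b₂ := by
  obtain ⟨φ, hφ⟩ := hb
  exact (h₂.isolates hφ b₁).1 ((h₁ φ).1 ((hφ b).2 rfl))

theorem SameType.exists_pair [Finite β] {c : Tuple M Γ} {c' : Tuple N Γ} (h : SameType M N c c')
    {b : Tuple M Δ} (hb : IsDefinableOver M c b) :
    ∃ b' : Tuple N Δ, SameType M N (pair c b) (pair c' b') := by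
  obtain ⟨φ, hφ⟩ := hb
  obtain ⟨b', hb'⟩ := (Formula.realize_ex N φ c').1
    ((h φ.ex).1 ((Formula.realize_ex M φ c).2 ⟨b, (hφ b).2 rfl⟩))
  have realize_of_realize (ψ : Formula L (Sum.elim Γ Δ)) (hψ : ψ.Realize M (pair c b)) :
      ψ.Realize N (pair c' b') := by
    have key := h (Formula.all (φ.imp ψ))
    simp only [Formula.realize_all, Formula.realize_imp, hφ, forall_eq] at key
    exact key.1 hψ b' hb'
  exact ⟨b', fun ψ => ⟨realize_of_realize ψ, fun hψ => by_contra fun hn =>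
    realize_of_realize ψ.not hn hψ⟩⟩

/-- The tuple `c` generates `M`: every element of `M` is definable over `c`. -/
def Generates (M : Struc L) (c : Tuple M Γ) : Prop :=
  ∀ s (b : M s), IsDefinableOver M c fun _ : Unit => b

theorem SameType.pair_of_components [Finite β] {c : Tuple M Γ} {c' : Tuple N Γ}
    (h : SameType M N c c') {b : Tuple M Δ} {b' : Tuple N Δ}
    (hb : ∀ k, IsDefinableOver M c fun _ : Unit => b k)
    (hbb' : ∀ k, SameType M N (pair c fun _ : Unit => b k) (pair c' fun _ => b' k)) :
    SameType M N (pair c b) (pair c' b') := by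
  obtain ⟨b'', hb''⟩ := h.exists_pair (IsDefinableOver.of_components hb)
  suffices b'' = b' from this ▸ hb''
  funext k
  have hk := hb''.sub (Sub.pair Sub.fst fun _ : Unit => Sub.snd k)
  rw [Sub.eval_pair, Sub.eval_pair, Sub.eval_fst, Sub.eval_fst] at hk
  exact congrFun (SameType.eq_of_isDefinableOver (hb k) hk (hbb' k)) ()

theorem SameType.exists_equiv {c : Tuple M Γ} {c' : Tuple N Γ} (h : SameType M N c c')
    (hc : Generates M c) (hc' : Generates N c') :
    ∃ τ : ∀ s, M s ≃ N s, (∀ (Q : DefSet L) (x : Tuple M Q.sort),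
      Q.form.Realize M x ↔ Q.form.Realize N fun j => τ _ (x j)) ∧ ∀ a, τ _ (c a) = c' a := by
  choose f hf using fun s (b : M s) => h.exists_pair (hc s b)
  choose g hg using fun s (b : N s) => h.symm.exists_pair (hc' s b)
  have eq_f {s} {b : M s} {b' : N s}
      (hb : SameType M N (pair c fun _ : Unit => b) (pair c' fun _ => b')) :
      f s b () = b' := congrFun (SameType.eq_of_isDefinableOver (hc s b) (hf s b) hb) ()
  have eq_g {s} {b : N s} {b' : M s}
      (hb : SameType N M (pair c' fun _ : Unit => b) (pair c fun _ => b')) :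
      g s b () = b' := congrFun (SameType.eq_of_isDefinableOver (hc' s b) (hg s b) hb) ()
  refine ⟨fun s => ⟨fun b => f s b (), fun b => g s b (), fun b => eq_g (hf s b).symm,
    fun b => eq_f (hg s b).symm⟩, fun Q x => ?_, fun a => eq_f ?_⟩
  · exact (h.pair_of_components (b' := fun k => f _ (x k) ()) (fun k => hc _ (x k))
      fun k => hf _ (x k)).sub Sub.snd Q.form
  · have ha := h.sub (Sub.pair Sub.id fun _ : Unit => Sub.id a)
    rwa [Sub.eval_pair, Sub.eval_pair] at ha

/-! ### Elementary maps -/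

theorem IsElementary.sameType {B : Subsets M} {f : ∀ s, B s → N s} (hf : IsElementary M N B f)
    (x : ∀ a, B (Γ a)) : SameType M N (fun a => (x a).1) fun a => f _ (x a) := fun φ => by
  obtain ⟨ι, _, g, φ', hφ'⟩ := φ.exists_support
  rw [hφ', hφ']
  exact hf ⟨ι, fun k => Γ (g k), φ'⟩ fun k => x (g k)

theorem IsElementary.sameType_pair {B : Subsets M} {f : ∀ s, B s → N s}
    (hf : IsElementary M N B f) (x : ∀ a, B (Γ a)) (y : ∀ b, B (Δ b)) :
    SameType M N (pair (fun a => (x a).1) fun b => (y b).1)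
      (pair (fun a => f _ (x a)) fun b => f _ (y b)) := by
  have h := hf.sameType (pair (M := fun s => B s) x y)
  rwa [map_pair (M := fun s => B s) fun s b => b.1, map_pair (M := fun s => B s) f] at h

theorem IsElementary.eq_of_eqOn {B : Subsets M} {f f' : ∀ s, B s → N s}
    (hf : IsElementary M N B f) (hf' : IsElementary M N B f') {C : Subsets M} (hC : C ≤ B)
    (h : ∀ s (c : C s), f s ⟨c.1, hC s c.2⟩ = f' s ⟨c.1, hC s c.2⟩) {s : L.Sorts} (b : B s)
    (hb : b.1 ∈ dcl M C s) : f s b = f' s b := by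
  let c : ∀ a : Σ t, C t, B a.1 := fun a => ⟨a.2.1, hC a.1 a.2.2⟩
  have hc : (fun a => f' _ (c a)) = fun a => f _ (c a) := funext fun a => (h a.1 a.2).symm
  have hb' := hf'.sameType_pair c fun _ : Unit => b
  rw [hc] at hb'
  exact congrFun (SameType.eq_of_isDefinableOver (mem_dcl_iff.1 hb)
    (hf.sameType_pair c fun _ : Unit => b) hb') ()

/-- `τ` is an automorphism of `M` over `F`: a family of permutations of the sorts that preserves
all definable sets and fixes the elements of `F`. -/
structure IsAutOver (M : Struc L) (F : Subsets M) (τ : ∀ s, Equiv.Perm (M s)) : Prop where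
  realize_iff : ∀ (Q : DefSet L) (x : Tuple M Q.sort),
    Q.form.Realize M x ↔ Q.form.Realize M fun j => τ _ (x j)
  apply_eq : ∀ s, ∀ b ∈ F s, τ s b = b

theorem IsAutOver.isElementary {F : Subsets M} {τ : ∀ s, Equiv.Perm (M s)}
    (hτ : IsAutOver M F τ) (B : Subsets M) : IsElementary M M B fun s b => τ s b.1 :=
  fun Q x => hτ.realize_iff Q fun k => (x k).1

end

/-! ### Translation of formulas along an interpretation -/

section

variable {L₀ L : Lang.{u}} {T₀ : Theory L₀} {T : Theory L} (i : Interp T₀ T) {α β κ : Type*}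
  {Γ : α → L₀.Sorts} {Δ : β → L₀.Sorts} {Θ : α → L.Sorts} {S : κ → L₀.Sorts}

theorem Interp.realize_graph (M : Model T) {a : List L₀.Sorts} {s : L₀.Sorts} (f : L₀.Fun a s)
    (z : Tuple (i.res M).toStruc a.get) (y : (i.res M).carrier s) :
    (i.graph f).Realize M.toStruc (pair (flatten z) (Subtype.val y)) ↔
      (i.res M).funMap f z = y :=
  have h := i.graph_total M f z
  ⟨fun hy => h.unique h.choose_spec.1 hy, fun hy => hy ▸ h.choose_spec.1⟩

/-- The projection from a product of sets `obj (S k)` to a factor. -/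
def flatProj (obj : L₀.Sorts → DefSet L) (S : κ → L₀.Sorts) (k : κ) :
    Sub L (flatSort obj S) (obj (S k)).sort :=
  fun j => Sub.id (Γ := flatSort obj S) ⟨k, j⟩

@[simp] theorem eval_flatProj (obj : L₀.Sorts → DefSet L) (k : κ) (M : Struc L)
    (y : Tuple M (flatSort obj S)) : (flatProj obj S k).eval M y = fun j => y ⟨k, j⟩ := rfl

/-- The formula saying that a tuple lies in the product of the sets `i.obj (S k)`. -/
noncomputable def Interp.domain [Finite κ] (S : κ → L₀.Sorts) : Formula L (flatSort i.obj S) :=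
  Formula.iAnd fun k => (i.obj (S k)).form.sub (flatProj i.obj S k)

theorem Interp.realize_domain [Finite κ] (M : Model T)
    (y : Tuple M.toStruc (flatSort i.obj S)) : (i.domain S).Realize M.toStruc y ↔
      ∃ z : Tuple (i.res M).toStruc S, flatten z = y := by
  simp only [Interp.domain, Formula.realize_iAnd, Formula.realize_sub, eval_flatProj]
  refine ⟨fun h => ⟨fun k => ⟨_, h k⟩, rfl⟩, ?_⟩
  rintro ⟨z, rfl⟩ k
  exact (z k).2

/-- Universal quantification over tuples of elements of the interpreted structure. -/
noncomputable def Interp.all [Finite κ] (φ : Formula L (Sum.elim Θ (flatSort i.obj S))) :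
    Formula L Θ :=
  Formula.all (((i.domain S).sub Sub.snd).imp φ)

/-- Existential quantification over tuples of elements of the interpreted structure. -/
noncomputable def Interp.ex [Finite κ] (φ : Formula L (Sum.elim Θ (flatSort i.obj S))) :
    Formula L Θ :=
  Formula.ex (((i.domain S).sub Sub.snd).and φ)

@[simp] theorem Interp.realize_all [Finite κ] (φ : Formula L (Sum.elim Θ (flatSort i.obj S)))
    (M : Model T) (x : Tuple M.toStruc Θ) : (i.all φ).Realize M.toStruc x ↔
      ∀ z : Tuple (i.res M).toStruc S, φ.Realize M.toStruc (pair x (flatten z)) := by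
  simp only [Interp.all, Formula.realize_all, Formula.realize_imp, Formula.realize_sub,
    Sub.eval_snd, i.realize_domain]
  exact ⟨fun h z => h _ ⟨z, rfl⟩, fun h _ ⟨z, hz⟩ => hz ▸ h z⟩

@[simp] theorem Interp.realize_ex [Finite κ] (φ : Formula L (Sum.elim Θ (flatSort i.obj S)))
    (M : Model T) (x : Tuple M.toStruc Θ) : (i.ex φ).Realize M.toStruc x ↔
      ∃ z : Tuple (i.res M).toStruc S, φ.Realize M.toStruc (pair x (flatten z)) := by
  simp only [Interp.ex, Formula.realize_ex, Formula.realize_and, Formula.realize_sub,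
    Sub.eval_snd, i.realize_domain]
  exact ⟨fun ⟨_, ⟨z, hz⟩, h⟩ => ⟨z, hz ▸ h⟩, fun ⟨z, h⟩ => ⟨_, ⟨z, rfl⟩, h⟩⟩

/-- The formula `χ(x, t(x))`, for a tuple `t` of functions whose graphs are defined by the
formulas `φ k`. -/
noncomputable def Interp.letIn [Finite κ] (φ : ∀ k, Formula L (Sum.elim Θ (i.obj (S k)).sort))
    (χ : Formula L (Sum.elim Θ (flatSort i.obj S))) : Formula L Θ :=
  i.ex ((Formula.iAnd fun k =>
    (φ k).sub (Sub.pair Sub.fst ((flatProj i.obj S k).comp Sub.snd))).and χ)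

theorem Interp.realize_letIn [Finite κ] {φ : ∀ k, Formula L (Sum.elim Θ (i.obj (S k)).sort)}
    (χ : Formula L (Sum.elim Θ (flatSort i.obj S))) {M : Model T} {x : Tuple M.toStruc Θ}
    {t : Tuple (i.res M).toStruc S}
    (ht : ∀ k (y : (i.res M).carrier (S k)),
      (φ k).Realize M.toStruc (pair x (Subtype.val y)) ↔ t k = y) :
    (i.letIn φ χ).Realize M.toStruc x ↔ χ.Realize M.toStruc (pair x (flatten t)) := by
  have ht' (z : Tuple (i.res M).toStruc S) :
      (∀ k, (φ k).Realize M.toStruc (pair x fun j => flatten z ⟨k, j⟩)) ↔ t = z :=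
    (forall_congr' fun k => ht k (z k)).trans funext_iff.symm
  simp only [Interp.letIn, Interp.realize_ex, Formula.realize_and, Formula.realize_iAnd,
    Formula.realize_sub, Sub.eval_pair, Sub.eval_comp, Sub.eval_fst, Sub.eval_snd, eval_flatProj,
    ht', exists_eq_left']

/-- The graph of a term of `L₀` in the interpreted structure. -/
noncomputable def Interp.termGraph {l : List L₀.Sorts} : ∀ {s : L₀.Sorts}, Term L₀ Γ l s →
    Formula L (Sum.elim (Sum.elim (flatSort i.obj Γ) (flatSort i.obj l.get)) (i.obj s).sort)
  | _, .free a => Formula.eqTuple ((flatProj i.obj Γ a).comp (Sub.fst.comp Sub.fst)) Sub.snd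
  | _, .bound k => Formula.eqTuple ((flatProj i.obj l.get k).comp (Sub.snd.comp Sub.fst)) Sub.snd
  | _, .app f ts =>
    i.letIn (fun k => (termGraph (ts k)).sub (Sub.pair (Sub.fst.comp Sub.fst) Sub.snd))
      ((i.graph f).sub (Sub.pair Sub.snd (Sub.snd.comp Sub.fst)))

theorem Interp.realize_termGraph {l : List L₀.Sorts} {s : L₀.Sorts} (t : Term L₀ Γ l s)
    (M : Model T) (x : Tuple (i.res M).toStruc Γ) (e : Tuple (i.res M).toStruc l.get)
    (y : (i.res M).carrier s) :
    (i.termGraph t).Realize M.toStruc (pair (pair (flatten x) (flatten e)) (Subtype.val y)) ↔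
      t.val (i.res M).toStruc x e = y := by
  induction t with
  | free a =>
    simp only [Interp.termGraph, Formula.realize_eqTuple, Sub.eval_comp, Sub.eval_fst,
      Sub.eval_snd, eval_flatProj]
    exact (Subtype.ext_iff (a1 := x a) (a2 := y)).symm
  | bound k =>
    simp only [Interp.termGraph, Formula.realize_eqTuple, Sub.eval_comp, Sub.eval_fst,
      Sub.eval_snd, eval_flatProj]
    exact (Subtype.ext_iff (a1 := e k) (a2 := y)).symm
  | app f ts ih =>
    refine (i.realize_letIn (t := fun k => (ts k).val (i.res M).toStruc x e) _
      fun k z => ?_).trans ?_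
    · simp only [Formula.realize_sub, Sub.eval_pair, Sub.eval_comp, Sub.eval_fst, Sub.eval_snd]
      exact ih k z
    · simp only [Formula.realize_sub, Sub.eval_pair, Sub.eval_comp, Sub.eval_fst, Sub.eval_snd]
      exact i.realize_graph M f _ y

/-- The context of the bound variables after one more quantifier. -/
def flatCons (obj : L₀.Sorts → DefSet L) (s : L₀.Sorts) (l : List L₀.Sorts) :
    Sub L (Sum.elim (flatSort obj l.get) (flatSort obj fun _ : Unit => s))
      (flatSort obj (s :: l).get)
  | ⟨⟨0, _⟩, j⟩ => Sub.snd (Δ := flatSort obj fun _ : Unit => s) ⟨(), j⟩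
  | ⟨⟨k + 1, h⟩, j⟩ =>
    Sub.fst (Γ := flatSort obj l.get) ⟨⟨k, Nat.lt_of_succ_lt_succ h⟩, j⟩

theorem eval_flatCons {s : L₀.Sorts} {l : List L₀.Sorts} (M : Model T)
    (e : Tuple (i.res M).toStruc l.get) (z : Tuple (i.res M).toStruc fun _ : Unit => s) :
    (flatCons i.obj s l).eval M.toStruc (pair (flatten e) (flatten z)) =
      flatten (consTuple (M := (i.res M).carrier) (z ()) e) := by
  funext ⟨⟨k, _⟩, j⟩
  cases k <;> rfl

/-- The translation of a formula of `L₀` into `L`. -/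
noncomputable def Interp.translateBForm : ∀ {l : List L₀.Sorts}, BForm L₀ Γ l →
    Formula L (Sum.elim (flatSort i.obj Γ) (flatSort i.obj l.get))
  | _, .falsum => Formula.bot
  | _, .eq (s := s) t₁ t₂ => i.letIn (S := fun _ : Unit => s) (fun _ => i.termGraph t₁)
      ((i.termGraph t₂).sub (Sub.pair Sub.fst ((flatProj i.obj _ ()).comp Sub.snd)))
  | _, .rel R ts => i.letIn (fun k => i.termGraph (ts k)) ((i.rel R).sub Sub.snd)
  | _, .imp φ ψ => (translateBForm φ).imp (translateBForm ψ)
  | l, .all s φ => i.all ((translateBForm φ).sub (Sub.pair (Sub.fst.comp Sub.fst)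
      ((flatCons i.obj s l).comp (Sub.pair (Sub.snd.comp Sub.fst) Sub.snd))))

theorem Interp.realize_translateBForm {l : List L₀.Sorts} (φ : BForm L₀ Γ l) (M : Model T)
    (x : Tuple (i.res M).toStruc Γ) (e : Tuple (i.res M).toStruc l.get) :
    (i.translateBForm φ).Realize M.toStruc (pair (flatten x) (flatten e)) ↔
      φ.Holds (i.res M).toStruc x e := by
  induction φ with
  | falsum => rfl
  | eq t₁ t₂ =>
    refine (i.realize_letIn (t := fun _ : Unit => t₁.val (i.res M).toStruc x e) _
      fun _ => i.realize_termGraph t₁ M x e).trans ?_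
    simp only [Formula.realize_sub, Sub.eval_pair, Sub.eval_comp, Sub.eval_fst, Sub.eval_snd]
    exact (i.realize_termGraph t₂ M x e _).trans eq_comm
  | rel R ts =>
    refine (i.realize_letIn (t := fun k => (ts k).val (i.res M).toStruc x e) _
      fun k => i.realize_termGraph (ts k) M x e).trans ?_
    rw [Formula.realize_sub, Sub.eval_snd]
    rfl
  | imp φ ψ ihφ ihψ => exact imp_congr (ihφ e) (ihψ e)
  | all s φ ih =>
    simp only [Interp.translateBForm, Interp.realize_all, Formula.realize_sub, Sub.eval_pair,
      Sub.eval_comp, Sub.eval_fst, Sub.eval_snd, eval_flatCons, ih]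
    exact ⟨fun h b => h fun _ => b, fun h z => h (z ())⟩

/-- The concatenation of flattened tuples as a flattened tuple. -/
def flatPair (obj : L₀.Sorts → DefSet L) (Γ : α → L₀.Sorts) (Δ : β → L₀.Sorts) :
    Sub L (Sum.elim (flatSort obj Γ) (flatSort obj Δ)) (flatSort obj (Sum.elim Γ Δ))
  | ⟨Sum.inl a, j⟩ => Sub.fst (Γ := flatSort obj Γ) ⟨a, j⟩
  | ⟨Sum.inr b, j⟩ => Sub.snd (Δ := flatSort obj Δ) ⟨b, j⟩

theorem eval_flatPair (M : Model T) (x : Tuple (i.res M).toStruc Γ)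
    (y : Tuple (i.res M).toStruc Δ) :
    (flatPair i.obj Γ Δ).eval M.toStruc (pair (flatten x) (flatten y)) =
      flatten (pair (M := (i.res M).carrier) x y) := by
  funext ⟨c, j⟩
  cases c <;> rfl

/-- The translation into `L` of a formula of `L₀` in two groups of variables. -/
noncomputable def Interp.translate (φ : Formula L₀ (Sum.elim Γ Δ)) :
    Formula L (Sum.elim (flatSort i.obj Γ) (flatSort i.obj Δ)) :=
  (i.translateBForm φ).sub (Sub.pair (flatPair i.obj Γ Δ) fun p => p.1.elim0)

theorem Interp.realize_translate (φ : Formula L₀ (Sum.elim Γ Δ)) (M : Model T)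
    (x : Tuple (i.res M).toStruc Γ) (y : Tuple (i.res M).toStruc Δ) :
    (i.translate φ).Realize M.toStruc (pair (flatten x) (flatten y)) ↔
      φ.Realize (i.res M).toStruc (pair x y) := by
  rw [Interp.translate, Formula.realize_sub, Sub.eval_pair, eval_flatPair]
  refine Iff.trans (iff_of_eq (congrArg _ (congrArg _ (funext fun p => p.1.elim0)))) <|
    i.realize_translateBForm φ M _ _

end

/-! ### Codes of fibres -/

section

variable {L₀ L : Lang.{u}} {T₀ : Theory L₀} {T : Theory L}

theorem Theory.ElimImaginaries.exists_fiber_code (hEI : T₀.ElimImaginaries) {ν : Type} {κ : Type*}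
    [Finite ν] [Finite κ] {Δ : ν → L₀.Sorts} {Γ : κ → L₀.Sorts}
    (Z : Formula L₀ (Sum.elim Δ Γ)) :
    ∃ (μ : Type) (_ : Finite μ) (Γ' : μ → L₀.Sorts) (F : Formula L₀ (Sum.elim Δ Γ')),
      ∀ N : Model T₀, ∃ code : Tuple N.toStruc Δ → Tuple N.toStruc Γ',
        (∀ w v, F.Realize N.toStruc (pair w v) ↔ code w = v) ∧
        ∀ w w', code w = code w' ↔
          ∀ y, Z.Realize N.toStruc (pair w y) ↔ Z.Realize N.toStruc (pair w' y) := by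
  let X : DefSet L₀ := ⟨ν, Δ, Formula.top⟩
  let E : Formula L₀ (Sum.elim X.sort X.sort) := Formula.all
    ((Z.sub (Sub.pair (Sub.fst.comp Sub.fst) Sub.snd)).iff
      (Z.sub (Sub.pair (Sub.snd.comp Sub.fst) Sub.snd)))
  have hE (N : Struc L₀) (w w' : Tuple N Δ) : E.Realize N (pair w w') ↔
      ∀ y, Z.Realize N (pair w y) ↔ Z.Realize N (pair w' y) := by
    simp [E, X]
  obtain ⟨μ, hμ, Γ', F, hF⟩ := hEI X E fun N => by
    simp only [hE]
    exact ⟨fun _ _ => Iff.rfl, fun h y => (h y).symm, fun h h' y => (h y).trans (h' y)⟩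
  refine ⟨μ, hμ, Γ', F, fun N => ?_⟩
  obtain ⟨f, hf, hfE⟩ := hF N
  let point (w : Tuple N.toStruc Δ) : X.pts N.toStruc := ⟨w, (Formula.realize_top _ _).2 trivial⟩
  exact ⟨fun w => f (point w), fun w v => (hf (point w) v).symm,
    fun w w' => (hfE (point w) (point w')).symm.trans (hE _ w w')⟩

theorem Interp.StablyEmbedded.exists_fiber_code {i : Interp T₀ T} (hi : i.StablyEmbedded)
    (hEI : T₀.ElimImaginaries) {ι κ : Type} [Finite ι] [Finite κ] {Γ : ι → L.Sorts}
    {Γ₀ : κ → L₀.Sorts} (φ : Formula L (Sum.elim Γ (flatSort i.obj Γ₀))) :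
    ∃ (μ : Type) (_ : Finite μ) (Γ' : μ → L₀.Sorts)
      (F : Formula L (Sum.elim Γ (flatSort i.obj Γ'))), ∀ M : Model T,
        ∃ code : Tuple M.toStruc Γ → Tuple (i.res M).toStruc Γ',
          (∀ x (v : Tuple (i.res M).toStruc Γ'),
            F.Realize M.toStruc (pair x (flatten v)) ↔ code x = v) ∧
          ∀ x x', code x = code x' → ∀ y : Tuple (i.res M).toStruc Γ₀,
            φ.Realize M.toStruc (pair x (flatten y)) ↔
              φ.Realize M.toStruc (pair x' (flatten y)) := by
  obtain ⟨ν, _, Δ, Z, hZ⟩ := hi ι κ Γ Γ₀ φ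
  obtain ⟨μ, hμ, Γ', F, hF⟩ := hEI.exists_fiber_code Z
  let hasFiber : Formula L (Sum.elim (Sum.elim Γ (flatSort i.obj Γ')) (flatSort i.obj Δ)) :=
    i.all ((φ.sub (Sub.pair (Sub.fst.comp (Sub.fst.comp Sub.fst)) Sub.snd)).iff
      ((i.translate Z).sub (Sub.pair (Sub.snd.comp Sub.fst) Sub.snd)))
  refine ⟨μ, hμ, Γ', i.ex (((i.translate F).sub
    (Sub.pair Sub.snd (Sub.snd.comp Sub.fst))).and hasFiber), fun M => ?_⟩
  obtain ⟨code, hcode, code_eq⟩ := hF (i.res M)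
  choose w hw using hZ M
  refine ⟨fun x => code (w x), fun x v => ?_, fun x x' h y => ?_⟩
  · simp only [hasFiber, Interp.realize_ex, Interp.realize_all, Interp.realize_translate,
      Formula.realize_and, Formula.realize_iff, Formula.realize_sub, Sub.eval_pair, Sub.eval_comp,
      Sub.eval_fst, Sub.eval_snd, hcode, hw, ← code_eq]
    exact ⟨fun ⟨z, hz, h⟩ => h.trans hz, fun h => ⟨w x, h, rfl⟩⟩
  · rw [hw, hw, (code_eq _ _).1 h y]

theorem Interp.StablyEmbedded.realize_pair_iff {i : Interp T₀ T} (hi : i.StablyEmbedded)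
    (hEI : T₀.ElimImaginaries) {M : Model T} {A : Subsets M.toStruc}
    (hA : IsDefClosed M.toStruc A) {f : ∀ s, A s → M.carrier s}
    (hf : IsElementary M.toStruc M.toStruc A f)
    (hfix : ∀ s (a : A s), a.1 ∈ i.inj M (i.restrict M A) s → f s a = a.1)
    {ι κ : Type} [Finite ι] [Finite κ] {Γ : ι → L.Sorts} {Γ₀ : κ → L₀.Sorts}
    (φ : Formula L (Sum.elim Γ (flatSort i.obj Γ₀))) (a : ∀ k, A (Γ k))
    (y : Tuple (i.res M).toStruc Γ₀) :
    φ.Realize M.toStruc (pair (fun k => (a k).1) (flatten y)) ↔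
      φ.Realize M.toStruc (pair (fun k => f _ (a k)) (flatten y)) := by
  obtain ⟨μ, _, Γ', F, hF⟩ := hi.exists_fiber_code hEI φ
  obtain ⟨code, hcode, realize_of_code_eq⟩ := hF M
  let v := code fun k => (a k).1
  have code_mem : ∀ p, flatten (obj := i.obj) (M := M.toStruc) v p ∈ A (flatSort i.obj Γ' p) := by
    refine hA.mem_of_isDefinableOver (c := fun k => (a k).1) (fun k => (a k).2)
      ⟨F.and ((i.domain Γ').sub Sub.snd), fun z => ?_⟩
    rw [Formula.realize_and, Formula.realize_sub, Sub.eval_snd, i.realize_domain]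
    constructor
    · rintro ⟨h, z, rfl⟩
      rw [← (hcode _ z).1 h]
    · rintro rfl
      exact ⟨(hcode _ v).2 rfl, v, rfl⟩
  have f_code : (fun p => f _ ⟨_, code_mem p⟩) = flatten (obj := i.obj) (M := M.toStruc) v :=
    funext fun p => hfix _ _ ⟨Γ' p.1, v p.1, fun j => code_mem ⟨p.1, j⟩, p.2, rfl⟩
  have h := (hf.sameType_pair a (fun p => ⟨_, code_mem p⟩) F).1 ((hcode _ v).2 rfl)
  rw [f_code] at h
  exact realize_of_code_eq _ _ ((hcode _ v).1 h).symm y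

/-! ### Automorphisms over the interpreted structure -/

/-- All elements of `M₀`, as one tuple of elements of `M` indexed by themselves. -/
abbrev Interp.enum (i : Interp T₀ T) (M : Model T) :
    Tuple M.toStruc (flatSort i.obj fun d : (Σ s₀, (i.obj s₀).pts M.toStruc) => d.1) :=
  flatten fun d => d.2

/-- The elements of `M` that are components of elements of `M₀`. -/
abbrev Interp.base (i : Interp T₀ T) (M : Model T) : Subsets M.toStruc :=
  i.inj M fun _ => Set.univ

theorem Interp.inj_mono (i : Interp T₀ T) (M : Model T) {B C : Subsets (i.res M).toStruc}
    (h : B ≤ C) : i.inj M B ≤ i.inj M C :=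
  fun _ _ ⟨s₀, x, hx, hj⟩ => ⟨s₀, x, h s₀ hx, hj⟩

theorem Interp.StablyEmbedded.sameType_enum {i : Interp T₀ T} (hi : i.StablyEmbedded)
    (hEI : T₀.ElimImaginaries) {M : Model T} {A : Subsets M.toStruc}
    (hA : IsDefClosed M.toStruc A) {f : ∀ s, A s → M.carrier s}
    (hf : IsElementary M.toStruc M.toStruc A f)
    (hfix : ∀ s (a : A s), a.1 ∈ i.inj M (i.restrict M A) s → f s a = a.1) :
    SameType M.toStruc M.toStruc (pair A.enum (i.enum M))
      (pair (fun a => f _ a.2) (i.enum M)) := by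
  intro φ
  obtain ⟨ι, κ, _, _, g, h, φ', hφ'⟩ := φ.exists_support_pair
  let ρ : Sub L (flatSort i.obj fun k => (h k).1.1) fun k => flatSort i.obj _ (h k) :=
    fun k => Sub.id (Γ := flatSort i.obj fun k => (h k).1.1) ⟨k, (h k).2⟩
  have key := hi.realize_pair_iff hEI hA hf hfix (φ'.sub (Sub.pair Sub.fst (ρ.comp Sub.snd)))
    (fun k => (g k).2) fun k => (h k).1.2
  simp only [Formula.realize_sub, Sub.eval_pair, Sub.eval_comp, Sub.eval_fst,
    Sub.eval_snd] at key
  rwa [hφ', hφ']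

theorem generates_of_dcl_eq_univ {M : Struc L} {C : Subsets M} (hC : ∀ s, dcl M C s = Set.univ)
    {α : Type*} {Γ : α → L.Sorts} {c : Tuple M Γ}
    (hc : ∀ s, ∀ b ∈ C s, IsDefinableOver M c fun _ : Unit => b) : Generates M c := fun s b =>
  .trans (fun k => hc _ _ k.2.2) (mem_dcl_iff.1 (hC s ▸ Set.mem_univ b))

namespace Interp.IsInternalityParams

variable {i : Interp T₀ T} {M : Model T} {A : Subsets M.toStruc}

theorem generates (hA : i.IsInternalityParams M A) {N : Model T} {f : ∀ s, A s → N.carrier s}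
    (hf : IsElementary M.toStruc N.toStruc A f) :
    Generates N.toStruc (pair (fun a : (Σ t, A t) => f _ a.2) (i.enum N)) := by
  refine generates_of_dcl_eq_univ (hA.2 N f hf) ?_
  let c := pair (fun a : (Σ t, A t) => f _ a.2) (i.enum N)
  rintro s _ (⟨s₀, x, -, k, ⟨⟩⟩ | ⟨a, rfl⟩)
  · exact isDefinableOver_component c (Sum.inr ⟨⟨s₀, x⟩, k⟩)
  · exact isDefinableOver_component c (Sum.inl ⟨s, a⟩)

theorem exists_isAutOver (hA : i.IsInternalityParams M A) (hi : i.StablyEmbedded)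
    (hEI : T₀.ElimImaginaries) {f : ∀ s, A s → M.carrier s}
    (hf : IsElementary M.toStruc M.toStruc A f)
    (hfix : ∀ s (a : A s), a.1 ∈ i.inj M (i.restrict M A) s → f s a = a.1) :
    ∃ τ, IsAutOver M.toStruc (i.base M) τ ∧ ∀ s (a : A s), τ s a.1 = f s a := by
  obtain ⟨τ, hτ, apply_enum⟩ := (hi.sameType_enum hEI hA.1 hf hfix).exists_equiv
    (hA.generates (N := M) (f := fun _ a => a.1) fun _ _ => Iff.rfl) (hA.generates hf)
  refine ⟨τ, ⟨hτ, ?_⟩, fun s a => apply_enum (Sum.inl ⟨s, a⟩)⟩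
  rintro s _ ⟨s₀, x, -, k, ⟨⟩⟩
  exact apply_enum (Sum.inr ⟨⟨s₀, x⟩, k⟩)

end Interp.IsInternalityParams

end

/-! ### Ultrapowers and compactness -/

section

variable {L : Lang.{u}} {T : Theory L}

theorem eventually_forall_iff_forall_eventually {J β : Type*} (U : Ultrafilter J)
    (P : J → β → Prop) :
    (∀ᶠ r in U, ∀ b, P r b) ↔ ∀ b : J → β, ∀ᶠ r in U, P r (b r) := by
  refine ⟨fun h b => h.mono fun r hr => hr (b r), fun h => ?_⟩
  by_contra hn
  simp only [← Ultrafilter.eventually_not, not_forall] at hn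
  have : Nonempty β := let ⟨_, b, _⟩ := hn.exists; ⟨b⟩
  obtain ⟨b, hb⟩ := Filter.skolem.1 hn
  obtain ⟨r, hr, hr'⟩ := ((h b).and hb).exists
  exact hr' hr

section Ultrapower

variable {J : Type u} (U : Ultrafilter J) {α β : Type*}

/-- The ultrapower of a structure. Symbols are interpreted through arbitrary representatives of
germs. -/
noncomputable def ultrapower (M : Struc L) : Struc L where
  carrier s := Filter.Germ (U : Filter J) (M s)
  funMap f x := ((fun r => M.funMap f fun k => (x k).out r : J → M _) : Filter.Germ _ _)
  relMap R x := ∀ᶠ r in U, M.relMap R fun k => (x k).out r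

variable {M : Struc L} {Γ : α → L.Sorts} {Δ : β → L.Sorts}

/-- The tuple of germs represented by a family of tuples. -/
def ultraTuple (x : J → Tuple M Γ) : Tuple (ultrapower U M) Γ :=
  fun a => ((fun r => x r a : J → M (Γ a)) : Filter.Germ (U : Filter J) (M (Γ a)))

theorem exists_ultraTuple_eq (y : Tuple (ultrapower U M) Γ) : ∃ x, ultraTuple U x = y :=
  ⟨fun r a => (y a).out r, funext fun a => Quotient.out_eq (y a)⟩

theorem eventually_out_ultraTuple {l : List L.Sorts} (x : J → Tuple M l.get) :
    ∀ᶠ r in U, (fun k => Quotient.out (ultraTuple U x k) r : Tuple M l.get) = x r := by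
  have eventually_out (k) : ∀ᶠ r in U, Quotient.out (ultraTuple U x k) r = x r k :=
    Filter.Germ.coe_eq.1 (Quotient.out_eq (ultraTuple U x k))
  exact (Filter.eventually_all.2 eventually_out).mono fun r hr => funext hr

theorem val_ultrapower {l : List L.Sorts} (x : J → Tuple M Γ) (e : J → Tuple M l.get)
    {s : L.Sorts} (t : Term L Γ l s) :
    t.val (ultrapower U M) (ultraTuple U x) (ultraTuple U e) =
      ((fun r => t.val M (x r) (e r) : J → M s) : Filter.Germ (U : Filter J) (M s)) := by
  induction t with
  | free a => rfl
  | bound k => rfl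
  | app f ts ih =>
    exact (congrArg ((ultrapower U M).funMap f) (funext ih)).trans <| Filter.Germ.coe_eq.2 <|
      (eventually_out_ultraTuple U fun r k => (ts k).val M (x r) (e r)).mono fun r hr =>
        congrArg (M.funMap f) hr

theorem consTuple_ultraTuple {l : List L.Sorts} {s : L.Sorts} (b : J → M s)
    (e : J → Tuple M l.get) :
    consTuple (M := (ultrapower U M).carrier) (b : Filter.Germ (U : Filter J) (M s))
      (ultraTuple U e) = ultraTuple U fun r => consTuple (b r) (e r) := by
  funext k
  rcases k with ⟨_ | k, h⟩ <;> rfl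

theorem holds_ultrapower {l : List L.Sorts} (φ : BForm L Γ l) (x : J → Tuple M Γ)
    (e : J → Tuple M l.get) : φ.Holds (ultrapower U M) (ultraTuple U x) (ultraTuple U e) ↔
      ∀ᶠ r in U, φ.Holds M (x r) (e r) := by
  induction φ with
  | falsum => simp only [BForm.Holds, Filter.eventually_false_iff_eq_bot, U.neBot.ne]
  | eq t₁ t₂ =>
    simp only [BForm.Holds, val_ultrapower]
    exact Filter.Germ.coe_eq
  | rel R ts =>
    simp only [BForm.Holds, val_ultrapower]
    exact Filter.eventually_congr <|
      (eventually_out_ultraTuple U fun r k => (ts k).val M (x r) (e r)).mono fun r hr =>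
        iff_of_eq (congrArg (M.relMap R) hr)
  | imp φ ψ ihφ ihψ => simp only [BForm.Holds, ihφ, ihψ, Ultrafilter.eventually_imp]
  | @all l s φ ih =>
    simp only [BForm.Holds, eventually_forall_iff_forall_eventually, ← ih,
      ← consTuple_ultraTuple]
    exact ⟨fun h b => h _, fun h b => Filter.Germ.inductionOn b h⟩

theorem realize_ultrapower (φ : Formula L Γ) (x : J → Tuple M Γ) :
    φ.Realize (ultrapower U M) (ultraTuple U x) ↔ ∀ᶠ r in U, φ.Realize M (x r) := by
  refine Iff.trans (iff_of_eq (congrArg (BForm.Holds _ _ φ) ?_))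
    (holds_ultrapower U φ x fun _ => nilPi)
  exact (eq_nilPi _).trans (eq_nilPi _).symm

theorem pair_ultraTuple (x : J → Tuple M Γ) (y : J → Tuple M Δ) :
    pair (ultraTuple U x) (ultraTuple U y) = ultraTuple U fun r => pair (x r) (y r) := by
  funext c
  cases c <;> rfl

end Ultrapower

/-- `j` is an elementary embedding of `M` into `N`. -/
abbrev IsElementaryEmbedding (M N : Struc L) (j : ∀ s, M s → N s) : Prop :=
  IsElementary M N (fun _ => Set.univ) fun s b => j s b.1

theorem IsElementaryEmbedding.sameType {M N : Struc L} {j : ∀ s, M s → N s}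
    (hj : IsElementaryEmbedding M N j) {α : Type*} {Γ : α → L.Sorts} (x : Tuple M Γ) :
    SameType M N x fun a => j _ (x a) :=
  IsElementary.sameType hj fun a => ⟨x a, trivial⟩

section Compactness

variable {α β τ : Type u} {Γ : α → L.Sorts} {Δ : β → L.Sorts}

theorem exists_elementary_extension (M : Model T) (c : Tuple M.toStruc Γ)
    (φ : τ → Formula L (Sum.elim Γ Δ))
    (hφ : ∀ S : Finset τ, ∃ y, ∀ t ∈ S, (φ t).Realize M.toStruc (pair c y)) :
    ∃ (N : Model T) (j : ∀ s, M.carrier s → N.carrier s),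
      IsElementaryEmbedding M.toStruc N.toStruc j ∧
      ∃ y, ∀ t, (φ t).Realize N.toStruc (pair (fun a => j _ (c a)) y) := by
  choose y hy using hφ
  let U : Ultrafilter (Finset τ) := Ultrafilter.of Filter.atTop
  let N : Model T := ⟨ultrapower U M.toStruc, fun ψ hψ => by
    obtain ⟨x, hx⟩ := exists_ultraTuple_eq U fun a : Empty => a.elim
    rw [← hx, realize_ultrapower]
    exact .of_forall fun r => (Subsingleton.elim (fun a => a.elim) (x r)) ▸ M.isModel ψ hψ⟩
  refine ⟨N, fun s b => ((fun _ => b : Finset τ → M.carrier s) : Filter.Germ _ _), fun Q x => ?_,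
    ultraTuple U y, fun t => ?_⟩
  · exact Filter.eventually_const.symm.trans
      (realize_ultrapower U Q.form fun _ k => (x k).1).symm
  · suffices (φ t).Realize N.toStruc (pair (ultraTuple U fun _ => c) (ultraTuple U y)) from this
    rw [pair_ultraTuple]
    refine (realize_ultrapower U (φ t) _).2 ?_
    filter_upwards [Ultrafilter.of_le _ (Filter.eventually_ge_atTop {t})] with S hS
    exact hy S t (Finset.singleton_subset_iff.1 hS)

theorem Formula.exists_ex (φ : Formula L (Sum.elim Γ Δ)) :
    ∃ ψ : Formula L Γ, ∀ M : Struc L, Nonempty (Tuple M Δ) → ∀ x : Tuple M Γ,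
      ψ.Realize M x ↔ ∃ y, φ.Realize M (pair x y) := by
  obtain ⟨S, _, φ', hφ'⟩ := φ.exists_support_right
  refine ⟨φ'.ex, fun M hM x => ?_⟩
  have := Classical.nonempty_pi.1 hM
  simp only [realize_ex, hφ']
  exact (Subtype.surjective_restrict (β := fun b => M (Δ b)) fun b => b ∈ S).exists

theorem exists_realize_ne_of_not_isDefinableOver {M : Struc L} {c : Tuple M Γ} {b : Tuple M Δ}
    {k : β} (hk : ¬ IsDefinableOver M c fun _ : Unit => b k) {φ : Formula L (Sum.elim Γ Δ)}
    (hφ : φ.Realize M (pair c b)) : ∃ y, φ.Realize M (pair c y) ∧ y k ≠ b k := by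
  obtain ⟨ψ, hψ⟩ := ((φ.sub (Sub.pair (Sub.fst.comp Sub.fst) Sub.snd)).and
    (Formula.eqTuple (fun _ : Unit => Sub.snd k) (Sub.snd.comp Sub.fst))).exists_ex
  by_contra! eq_of_realize
  refine hk ⟨ψ, fun z => ?_⟩
  simp only [hψ M ⟨b⟩, Formula.realize_and, Formula.realize_sub, Formula.realize_eqTuple,
    Sub.eval_pair, Sub.eval_comp, Sub.eval_fst, Sub.eval_snd]
  constructor
  · rintro ⟨y, hy, hz⟩
    exact hz.symm.trans (funext fun _ => eq_of_realize y hy)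
  · rintro rfl
    exact ⟨b, hφ, rfl⟩

theorem isDefinableOver_of_forall_elementary_extension {M : Model T} {c : Tuple M.toStruc Γ}
    {b : Tuple M.toStruc Δ} {φ : τ → Formula L (Sum.elim Γ Δ)}
    (hφ : ∀ t, (φ t).Realize M.toStruc (pair c b))
    (h : ∀ (N : Model T) (j : ∀ s, M.carrier s → N.carrier s),
      IsElementaryEmbedding M.toStruc N.toStruc j →
      ∀ y, (∀ t, (φ t).Realize N.toStruc (pair (fun a => j _ (c a)) y)) → y = fun k => j _ (b k))
    (k : β) : IsDefinableOver M.toStruc c fun _ : Unit => b k := by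
  by_contra hk
  let φ' : Option τ → Formula L (Sum.elim (Sum.elim Γ Δ) Δ)
    | none => (Formula.eq (Sub.snd k) (Sub.snd.comp Sub.fst k)).not
    | some t => (φ t).sub (Sub.pair (Sub.fst.comp Sub.fst) Sub.snd)
  have realize_none (N : Struc L) (c b y) : (φ' none).Realize N (pair (pair c b) y) ↔ y k ≠ b k :=
    Iff.rfl
  have realize_some (N : Struc L) (t c b y) :
      (φ' (some t)).Realize N (pair (pair c b) y) ↔ (φ t).Realize N (pair c y) := by simp [φ']
  obtain ⟨N, j, hj, y, hy⟩ := exists_elementary_extension M (pair c b) φ' fun S => by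
    obtain ⟨y, hy, hyk⟩ := exists_realize_ne_of_not_isDefinableOver hk
      (φ := Formula.iAnd fun t : S.eraseNone => φ t)
      ((Formula.realize_iAnd _ _ _).2 fun t => hφ t)
    rw [Formula.realize_iAnd] at hy
    refine ⟨y, Option.rec (fun _ => (realize_none _ _ _ _).2 hyk) fun t ht => ?_⟩
    exact (realize_some _ _ _ _ _).2 (hy ⟨t, Finset.mem_eraseNone.2 ht⟩)
  rw [map_pair] at hy
  exact (realize_none _ _ _ _).1 (hy none)
    (congrFun (h N j hj y fun t => (realize_some _ _ _ _ _).1 (hy (some t))) k)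

end Compactness

end

/-! ### The Galois pro-group -/

section

variable {L₀ L : Lang.{u}} {T₀ : Theory L₀} {T : Theory L} {G : ProGroup T}

namespace ProGroup

/-- The sorts of the coordinates of the elements of all groups of the system. -/
def flatSort (G : ProGroup T) : (Σ k, (G.grp k).ι) → L.Sorts :=
  fun p => (G.grp p.1).sort p.2

/-- A point of the pro-group, as one tuple of elements of the model. -/
def flat (G : ProGroup T) {M : Model T} (g : G.pts M) : Tuple M.toStruc G.flatSort :=
  fun p => (g.1 p.1).1 p.2

/-- The projection of the variables `G.flatSort` to those of one group of the system. -/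
def coord (G : ProGroup T) (k : G.I) : Sub L G.flatSort (G.grp k).sort :=
  fun j => Sub.id (Γ := G.flatSort) ⟨k, j⟩

theorem eval_coord (G : ProGroup T) {M : Model T} (g : G.pts M) (k : G.I) :
    (G.coord k).eval M.toStruc (G.flat g) = (g.1 k).1 := rfl

theorem exists_realize_iff_flat (G : ProGroup T) : ∃ Φ : Set (Formula L G.flatSort),
    ∀ (M : Model T) (y : Tuple M.toStruc G.flatSort),
      (∀ φ ∈ Φ, φ.Realize M.toStruc y) ↔ ∃ g : G.pts M, G.flat g = y := by
  choose graph hgraph using fun (k l : G.I) (h : k ≤ l) => G.map_def h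
  refine ⟨Set.range (fun k => (G.grp k).form.sub (G.coord k)) ∪
    Set.range (fun t : {p : G.I × G.I // p.1 ≤ p.2} =>
      (graph t.1.1 t.1.2 t.2).sub (Sub.pair (G.coord t.1.2) (G.coord t.1.1))), fun M y => ?_⟩
  simp only [Set.mem_union, or_imp, forall_and, Set.forall_mem_range, Formula.realize_sub,
    Sub.eval_pair, Subtype.forall, Prod.forall]
  constructor
  · rintro ⟨mem_form, compatible⟩
    exact ⟨⟨fun k => ⟨_, mem_form k⟩, fun k l h => (hgraph k l h M _ _).2 (compatible k l h)⟩, rfl⟩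
  · rintro ⟨g, rfl⟩
    exact ⟨fun k => (g.1 k).2, fun k l h => (hgraph k l h M _ _).1 (g.2 k l h)⟩

end ProGroup

/-- A sort, as a definable set. -/
def sortSet (s : L.Sorts) : DefSet L := ⟨Unit, fun _ => s, Formula.top⟩

/-- An element of a sort, as a point of the definable set `sortSet s`. -/
def sortPt (M : Struc L) {s : L.Sorts} (b : M s) : (sortSet s).pts M :=
  ⟨fun _ => b, (Formula.realize_top _ _).2 trivial⟩

theorem ProGroup.Action.exists_graph (m : G.Action) (Q : DefSet L) :
    ∃ φ : Formula L (Sum.elim (Sum.elim G.flatSort Q.sort) Q.sort),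
      ∀ (M : Model T) (g : G.pts M) (x y : Q.pts M.toStruc),
        φ.Realize M.toStruc (pair (pair (G.flat g) x.1) y.1) ↔ m.apply g Q x = y := by
  obtain ⟨φ, hφ⟩ := m.act_def Q
  refine ⟨φ.sub (Sub.pair (Sub.pair ((G.coord _).comp (Sub.fst.comp Sub.fst))
    (Sub.snd.comp Sub.fst)) Sub.snd), fun M g x y => ?_⟩
  simp only [Formula.realize_sub, Sub.eval_pair, Sub.eval_comp, Sub.eval_fst, Sub.eval_snd,
    ProGroup.eval_coord]
  exact (hφ M _ x y).symm

theorem ProGroup.Action.exists_formulas (m : G.Action) {α : Type u} (Γ : α → L.Sorts) :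
    ∃ (τ : Type u) (φ : τ → Formula L (Sum.elim (Sum.elim Γ Γ) G.flatSort)),
      ∀ (M : Model T) (c c' : Tuple M.toStruc Γ) (y : Tuple M.toStruc G.flatSort),
        (∀ t, (φ t).Realize M.toStruc (pair (pair c c') y)) ↔ ∃ g : G.pts M, G.flat g = y ∧
          ∀ a, m.apply g (sortSet _) (sortPt M.toStruc (c a)) = sortPt M.toStruc (c' a) := by
  obtain ⟨Φ, hΦ⟩ := G.exists_realize_iff_flat
  choose graph hgraph using fun s => m.exists_graph (sortSet s)
  let entry (ρ : Sub L (Sum.elim (Sum.elim Γ Γ) G.flatSort) Γ) (a : α) :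
      Sub L (Sum.elim (Sum.elim Γ Γ) G.flatSort) (sortSet (Γ a)).sort := fun _ => ρ a
  refine ⟨Φ ⊕ α, Sum.elim (fun χ => χ.1.sub Sub.snd) fun a => (graph (Γ a)).sub
    (Sub.pair (Sub.pair Sub.snd (entry (Sub.fst.comp Sub.fst) a)) (entry (Sub.snd.comp Sub.fst) a)),
    fun M c c' y => ?_⟩
  simp only [Sum.forall, Sum.elim_inl, Sum.elim_inr, Formula.realize_sub, Sub.eval_pair,
    Sub.eval_snd, Subtype.forall, hΦ]
  constructor
  · rintro ⟨⟨g, rfl⟩, hg⟩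
    exact ⟨g, rfl, fun a => (hgraph _ M g _ _).1 (hg a)⟩
  · rintro ⟨g, rfl, hg⟩
    exact ⟨⟨g, rfl⟩, fun a => (hgraph _ M g _ _).2 (hg a)⟩

/-- `E` identifies `G(M)` with `Aut(M/M₀)`, through the action. -/
structure IsGaloisHom (i : Interp T₀ T) (m : G.Action) (M : Model T)
    (E : G.pts M →* (∀ s, Equiv.Perm (M.carrier s))) : Prop where
  injective : Function.Injective E
  mem_range_iff : ∀ τ, τ ∈ E.range ↔ IsAutOver M.toStruc (i.base M) τ
  apply_eq : ∀ (g : G.pts M) (Q : DefSet L) (x : Q.pts M.toStruc) (j : Q.ι),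
    (m.apply g Q x).1 j = E g (Q.sort j) (x.1 j)

theorem ProGroup.Action.IsGalois.exists_hom {i : Interp T₀ T} {m : G.Action} (hG : m.IsGalois i)
    (M : Model T) : ∃ E, IsGaloisHom i m M E := by
  obtain ⟨GB, hGB, e, apply_eq⟩ := hG M
  obtain rfl : GB = ⊤ := eq_top_iff.2 fun g _ => (hGB g).2 fun _ _ => trivial
  let E : G.pts M →* (∀ s, Equiv.Perm (M.carrier s)) :=
    .mk' (fun g s => (Equiv.Set.univ _).permCongr ((e ⟨g, trivial⟩).1 s)) fun g g' => by
      have e_mul : e ⟨g * g', trivial⟩ = e ⟨g, trivial⟩ * e ⟨g', trivial⟩ :=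
        map_mul e ⟨g, trivial⟩ ⟨g', trivial⟩
      rw [e_mul]
      rfl
  refine ⟨E, fun g g' h => ?_, fun τ => ⟨?_, fun hτ => ?_⟩,
    fun g Q x => apply_eq ⟨g, trivial⟩ Q x fun _ => trivial⟩
  · have he : e ⟨g, trivial⟩ = e ⟨g', trivial⟩ :=
      Subtype.ext <| funext fun s => (Equiv.Set.univ _).permCongr.injective (congrFun h s)
    exact congrArg Subtype.val (e.injective he)
  · rintro ⟨g, rfl⟩
    exact ⟨fun Q x => (e ⟨g, trivial⟩).2.1 Q fun j => ⟨x j, trivial⟩,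
      fun s b hb => congrArg Subtype.val ((e ⟨g, trivial⟩).2.2 s ⟨b, trivial⟩ hb)⟩
  · let σ : autGroup M.toStruc (fun _ => Set.univ) (i.base M) :=
      ⟨fun s => (Equiv.Set.univ _).symm.permCongr (τ s),
        fun Q x => hτ.realize_iff Q fun j => (x j).1,
        fun s b hb => Subtype.ext (hτ.apply_eq s b.1 hb)⟩
    refine ⟨(e.symm σ).1, funext fun s => Equiv.ext fun b => ?_⟩
    exact congrArg (fun σ => (σ.1 s ⟨b, trivial⟩).1) (e.apply_symm_apply σ)

namespace IsGaloisHom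

variable {i : Interp T₀ T} {m : G.Action} {M : Model T}
  {E : G.pts M →* (∀ s, Equiv.Perm (M.carrier s))}

theorem isAutOver (hE : IsGaloisHom i m M E) (g : G.pts M) :
    IsAutOver M.toStruc (i.base M) (E g) :=
  (hE.mem_range_iff _).1 ⟨g, rfl⟩

theorem apply_sortPt_eq_iff (hE : IsGaloisHom i m M E) (g : G.pts M) {s : L.Sorts}
    (a b : M.carrier s) :
    m.apply g (sortSet s) (sortPt M.toStruc a) = sortPt M.toStruc b ↔ E g s a = b := by
  have apply_sortPt := hE.apply_eq g (sortSet s) (sortPt M.toStruc a)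
  exact ⟨fun h => (apply_sortPt ()).symm.trans (congrFun (congrArg Subtype.val h) ()),
    fun h => Subtype.ext (funext fun j => (apply_sortPt j).trans h)⟩

end IsGaloisHom

theorem Interp.IsInternalityParams.eq_of_eqOn {i : Interp T₀ T} {M N : Model T}
    {A : Subsets M.toStruc} (hA : i.IsInternalityParams M A) {f : ∀ s, A s → N.carrier s}
    (hf : IsElementary M.toStruc N.toStruc A f) {τ τ' : ∀ s, Equiv.Perm (N.carrier s)}
    (hτ : IsAutOver N.toStruc (i.base N) τ) (hτ' : IsAutOver N.toStruc (i.base N) τ')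
    (h : ∀ s a, τ s (f s a) = τ' s (f s a)) : τ = τ' := by
  funext s
  ext b
  refine (hτ.isElementary fun _ => Set.univ).eq_of_eqOn (hτ'.isElementary _)
    (fun _ => Set.subset_univ _) ?_ ⟨b, trivial⟩ (hA.2 N f hf s ▸ Set.mem_univ b)
  rintro s ⟨_, hc | ⟨a, rfl⟩⟩
  · exact (hτ.apply_eq s _ hc).trans (hτ'.apply_eq s _ hc).symm
  · exact h s a

theorem Interp.IsInternalityParams.coord_mem_of_apply_mem {i : Interp T₀ T} {m : G.Action}
    (hG : m.IsGalois i) {M : Model T} {A B : Subsets M.toStruc} (hA : i.IsInternalityParams M A)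
    (hB : IsDefClosed M.toStruc B) (hAB : A ≤ B) {E : G.pts M →* (∀ s, Equiv.Perm (M.carrier s))}
    (hE : IsGaloisHom i m M E) {g : G.pts M} (hg : ∀ s (a : A s), E g s a ∈ B s) (k : G.I)
    (j : (G.grp k).ι) : (g.1 k).1 j ∈ B ((G.grp k).sort j) := by
  obtain ⟨τ, φ, hφ⟩ := m.exists_formulas fun a : (Σ s, A s) => a.1
  have hφg : ∀ t, (φ t).Realize M.toStruc
      (pair (pair A.enum fun a : (Σ s, A s) => E g _ a.2.1) (G.flat g)) :=
    (hφ M _ _ _).2 ⟨g, rfl, fun a => (hE.apply_sortPt_eq_iff g _ _).2 rfl⟩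
  refine hB.mem_of_isDefinableOver (Sum.rec (fun a => hAB a.1 a.2.2) fun a => hg a.1 a.2)
    (isDefinableOver_of_forall_elementary_extension hφg (fun N f hf y hy => ?_) ⟨k, j⟩) ()
  simp only [map_pair] at hy
  obtain ⟨h, rfl, apply_h⟩ := (hφ N _ _ _).1 hy
  obtain ⟨g', flat_g', apply_g'⟩ := (hφ N (fun a => f _ (A.enum a)) (fun a => f _ (E g _ a.2.1))
    fun p => f _ (G.flat g p)).1 fun t => by
      simpa only [map_pair] using (hf.sameType _ (φ t)).1 (hφg t)
  obtain ⟨E', hE'⟩ := hG.exists_hom N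
  have hfA : IsElementary M.toStruc N.toStruc A fun s a => f s a.1 := fun Q x =>
    hf Q fun k => ⟨x k, trivial⟩
  have h_eq : h = g' := hE'.injective <|
    hA.eq_of_eqOn hfA (hE'.isAutOver h) (hE'.isAutOver g') fun s a =>
      ((hE'.apply_sortPt_eq_iff h _ _).1 (apply_h ⟨s, a⟩)).trans
        ((hE'.apply_sortPt_eq_iff g' _ _).1 (apply_g' ⟨s, a⟩)).symm
  rw [h_eq, flat_g']

end

/-! ### Points in a definably closed set -/

section

variable {L₀ L : Lang.{u}} {T₀ : Theory L₀} {T : Theory L} {M : Model T} {B : Subsets M.toStruc}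

theorem IsDefClosed.pts_mem (hB : IsDefClosed M.toStruc B) {Q : DefSet L} (x : Q.pts M.toStruc)
    {α : Type*} {Γ : α → L.Sorts} {c : Tuple M.toStruc Γ} (hc : ∀ a, c a ∈ B (Γ a))
    (φ : Formula L (Sum.elim Γ Q.sort))
    (hφ : ∀ y : Q.pts M.toStruc, φ.Realize M.toStruc (pair c y.1) ↔ y = x) (j : Q.ι) :
    x.1 j ∈ B (Q.sort j) := by
  refine hB.mem_of_isDefinableOver hc ⟨φ.and (Q.form.sub Sub.snd), fun y => ?_⟩ j
  rw [Formula.realize_and, Formula.realize_sub, Sub.eval_snd]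
  constructor
  · rintro ⟨hy, hQ⟩
    exact congrArg Subtype.val ((hφ ⟨y, hQ⟩).1 hy)
  · rintro rfl
    exact ⟨(hφ x).2 rfl, x.2⟩

namespace DefGroup

theorem mul_mem (H : DefGroup T) (hB : IsDefClosed M.toStruc B) {x y : H.pts M}
    (hx : ∀ j, x.1 j ∈ B (H.sort j)) (hy : ∀ j, y.1 j ∈ B (H.sort j)) (j : H.ι) :
    (x * y).1 j ∈ B (H.sort j) := by
  obtain ⟨μ, hμ⟩ := H.mul_def
  exact hB.pts_mem (x * y) (c := pair x.1 y.1) (Sum.rec hx hy) μ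
    (fun z => (hμ M x y z).symm.trans eq_comm) j

theorem one_mem (H : DefGroup T) (hB : IsDefClosed M.toStruc B) (j : H.ι) :
    (1 : H.pts M).1 j ∈ B (H.sort j) := by
  obtain ⟨μ, hμ⟩ := H.mul_def
  refine hB.pts_mem (1 : H.pts M) (Γ := Empty.elim) (c := Empty.rec) Empty.rec
    (μ.sub (Sub.pair (Sub.pair Sub.snd Sub.snd) Sub.snd)) (fun z => ?_) j
  simp only [Formula.realize_sub, Sub.eval_pair, Sub.eval_snd]
  exact (hμ M z z z).symm.trans (mul_eq_left (M := H.pts M))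

theorem inv_mem (H : DefGroup T) (hB : IsDefClosed M.toStruc B) {x : H.pts M}
    (hx : ∀ j, x.1 j ∈ B (H.sort j)) (j : H.ι) : (x⁻¹).1 j ∈ B (H.sort j) := by
  obtain ⟨μ, hμ⟩ := H.mul_def
  refine hB.pts_mem (x⁻¹ : H.pts M) (c := pair x.1 (1 : H.pts M).1) (Sum.rec hx (H.one_mem hB))
    (μ.sub (Sub.pair (Sub.pair (Sub.fst.comp Sub.fst) Sub.snd) (Sub.snd.comp Sub.fst)))
    (fun z => ?_) j
  simp only [Formula.realize_sub, Sub.eval_pair, Sub.eval_comp, Sub.eval_fst, Sub.eval_snd]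
  exact (hμ M x z (1 : H.pts M)).symm.trans (mul_eq_one_iff_eq_inv' (G := H.pts M))

end DefGroup

/-- The group `G(B)` of points of the pro-group with coordinates in a definably closed set. -/
def ProGroup.ptsIn (G : ProGroup T) (hB : IsDefClosed M.toStruc B) : Subgroup (G.pts M) where
  carrier := {g | ∀ k j, (g.1 k).1 j ∈ B ((G.grp k).sort j)}
  one_mem' k := (G.grp k).one_mem hB
  mul_mem' hg hh k := (G.grp k).mul_mem hB (hg k) (hh k)
  inv_mem' hg k := (G.grp k).inv_mem hB (hg k)

variable {G : ProGroup T} {m : G.Action} {i : Interp T₀ T} {F A : Subsets M.toStruc}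
  {E : G.pts M →* (∀ s, Equiv.Perm (M.carrier s))}

namespace IsGaloisHom

theorem apply_mem (hE : IsGaloisHom i m M E) (hB : IsDefClosed M.toStruc B) {g : G.pts M}
    (hg : g ∈ G.ptsIn hB) {s : L.Sorts} {b : M.carrier s} (hb : b ∈ B s) : E g s b ∈ B s := by
  obtain ⟨φ, hφ⟩ := m.exists_graph (sortSet s)
  refine hB.pts_mem (sortPt M.toStruc (E g s b)) (c := pair (G.flat g) (sortPt M.toStruc b).1)
    (Sum.rec (fun p => hg p.1 p.2) fun _ => hb) φ (fun y => ?_) ()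
  rw [hφ, (hE.apply_sortPt_eq_iff g _ _).2 rfl, eq_comm]

theorem apply_mem_iff (hE : IsGaloisHom i m M E) (hB : IsDefClosed M.toStruc B) {g : G.pts M}
    (hg : g ∈ G.ptsIn hB) {s : L.Sorts} (b : M.carrier s) : E g s b ∈ B s ↔ b ∈ B s := by
  refine ⟨fun h => ?_, hE.apply_mem hB hg⟩
  have apply_inv_mem := hE.apply_mem hB (inv_mem hg) h
  rwa [map_inv, Pi.inv_apply, Equiv.Perm.inv_def, Equiv.symm_apply_apply] at apply_inv_mem

/-- The homomorphism `G(B) → Aut(B/F)` given by the action. -/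
def restrict (hE : IsGaloisHom i m M E) (hB : IsDefClosed M.toStruc B) (hF : F ≤ i.base M) :
    G.ptsIn hB →* autGroup M.toStruc B F where
  toFun g := ⟨fun s => (E g.1 s).subtypePerm (hE.apply_mem_iff hB g.2),
    fun Q x => (hE.isAutOver g.1).realize_iff Q fun j => (x j).1,
    fun s b hb => Subtype.ext ((hE.isAutOver g.1).apply_eq s b.1 (hF s hb))⟩
  map_one' := Subtype.ext <| funext fun s => Equiv.ext fun b => Subtype.ext <|
    congrFun (congrArg DFunLike.coe (congrFun (map_one E) s)) b.1
  map_mul' g g' := Subtype.ext <| funext fun s => Equiv.ext fun b => Subtype.ext <|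
    congrFun (congrArg DFunLike.coe (congrFun (map_mul E g.1 g'.1) s)) b.1

theorem restrict_injective (hE : IsGaloisHom i m M E) (hA : i.IsInternalityParams M A)
    (hB : IsDefClosed M.toStruc B) (hAB : A ≤ B) (hF : F ≤ i.base M) :
    Function.Injective (hE.restrict hB hF) := fun g g' h => by
  refine Subtype.ext <| hE.injective <| hA.eq_of_eqOn (f := fun s a => a.1) (fun _ _ => Iff.rfl)
    (hE.isAutOver g.1) (hE.isAutOver g'.1) fun s a => ?_
  exact congrArg (fun σ => (σ.1 s ⟨a.1, hAB s a.2⟩).1) h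

theorem restrict_surjective (hE : IsGaloisHom i m M E) (hG : m.IsGalois i)
    (hA : i.IsInternalityParams M A) (hi : i.StablyEmbedded) (hEI : T₀.ElimImaginaries)
    (hB : IsDefClosed M.toStruc B) (hAB : A ≤ B) (hF₀ : i.inj M (i.restrict M A) ≤ F)
    (hF : F ≤ i.base M) (hBA : B ≤ dcl M.toStruc fun s => A s ∪ F s) (hFB : F ≤ B) :
    Function.Surjective (hE.restrict hB hF) := by
  rintro ⟨σ, hσ⟩
  have hσB : IsElementary M.toStruc M.toStruc B fun s b => (σ s b).1 := hσ.1
  obtain ⟨τ, hτ, τ_eq⟩ := hA.exists_isAutOver hi hEI (f := fun s a => (σ s ⟨a.1, hAB s a.2⟩).1)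
    (fun Q x => hσB Q fun k => ⟨(x k).1, hAB _ (x k).2⟩)
    fun s a ha => congrArg Subtype.val (hσ.2 s ⟨a.1, hAB s a.2⟩ (hF₀ s ha))
  obtain ⟨g, rfl⟩ := (hE.mem_range_iff τ).2 hτ
  have hg : g ∈ G.ptsIn hB :=
    hA.coord_mem_of_apply_mem hG hB hAB hE fun s a => τ_eq s a ▸ (σ s ⟨a.1, hAB s a.2⟩).2
  refine ⟨⟨g, hg⟩, Subtype.ext <| funext fun s => Equiv.ext fun b => Subtype.ext ?_⟩
  refine (hτ.isElementary B).eq_of_eqOn hσB (sup_le hAB hFB) ?_ b (hBA s b.2)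
  rintro s ⟨c, hc | hc⟩
  · exact τ_eq s ⟨c, hc⟩
  · exact (hτ.apply_eq s c (hF s hc)).trans
      (congrArg Subtype.val (hσ.2 s ⟨c, hFB s hc⟩ hc)).symm

end IsGaloisHom

end

end ManySorted

open ManySorted in
theorem mainTheorem6_general {L₀ L : Lang.{u}} {T₀ : Theory L₀} {T : Theory L}
    (hEI : T₀.ElimImaginaries) {i : Interp T₀ T} (hi : i.StablyEmbedded) {G : ProGroup T}
    {m : G.Action} (hG : m.IsGalois i) {M : Model T} {A : Subsets M.toStruc}
    (hA : i.IsInternalityParams M A) {F : Subsets M.toStruc}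
    (hF₀ : i.inj M (i.restrict M A) ≤ F) (hF : F ≤ i.base M) :
    m.IdentifiesWithAut M (dcl M.toStruc fun s => A s ∪ F s) F := by
  obtain ⟨E, hE⟩ := hG.exists_hom M
  have hB := isDefClosed_dcl fun s => A s ∪ F s
  obtain ⟨hAB, hFB⟩ := sup_le_iff.1 (subset_dcl fun s => A s ∪ F s)
  exact ⟨G.ptsIn hB, fun g => Iff.rfl, .ofBijective (hE.restrict hB hF)
    ⟨hE.restrict_injective hA hB hAB hF,
      hE.restrict_surjective hG hA hi hEI hB hAB hF₀ hF le_rfl hFB⟩,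
    fun g Q x _ j => hE.apply_eq g.1 Q x j⟩

theorem mainTheorem6 {L₀ L : ManySorted.Lang.{u}}
    (T₀ : ManySorted.Theory L₀) (T : ManySorted.Theory L)
    (hEI : T₀.ElimImaginaries)
    (i : ManySorted.Interp T₀ T) (hi : i.IsInternalCover)
    (G : ManySorted.ProGroup T) (m : G.Action) (hG : m.IsGalois i)
    (M : ManySorted.Model T)
    (A : ManySorted.Subsets M.toStruc) (hA : i.IsInternalityParams M A)
    (B₀ : ManySorted.Subsets (i.res M).toStruc)
    (hB₀ : ManySorted.IsDefClosed (i.res M).toStruc B₀)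
    (hAB : i.restrict M A ≤ B₀) :
    m.IdentifiesWithAut M
      (ManySorted.dcl M.toStruc (fun s => A s ∪ i.inj M B₀ s)) (i.inj M B₀) :=
  mainTheorem6_general hEI hi.1 hG hA (i.inj_mono M hAB) (i.inj_mono M fun _ => Set.subset_univ _)
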